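/- Let $T>0$, let $(\Omega,\mathcal A,\mathbb P)$ be a probability space with a filtration $(\mathcal F_t)_{t\ge 0}$, and let $W=(W^1,\ldots,W^d)$ be a $d$-dimensional standard $(\mathcal F_t)$-Brownian motion (for instance with respect to its natural filtration). Write $L^2_T=L^2([0,T],dt)$. Let $\widehat W=(\widehat W^1,\ldots,\widehat W^d)$ be a componentwise, pathwise continuous, stationary quantization of $W$ on $[0,T]$, that is, for every $i\in\{1,\ldots,d\}$: * there are a countable (e.g. finite) set $\alpha_i\subset L^2_T$ and a Borel partition $(C_a)_{a\in\alpha_i}$ of $L^2_T$ with $C_a\subset\{x:\ |x-a|_{L^2_T}=\min_{b\in\alpha_i}|x-b|_{L^2_T}\}$ for all $a\in\alpha_i$, such that, almost surely, $\widehat W^i=\sum_{a\in\alpha_i}a\,\mathbf 1_{\{W^i\in C_a\}}$ in $L^2_T$; * $\widehat W^i=(\widehat W^i_t)_{t\in[0,T]}$ is a process with almost surely continuous paths; * $\widehat W^i=\mathbb E(W^i\,|\,\sigma(\widehat W^i))$ a.s., as $L^2_T$-valued random variables. (No optimality is required.) Let $\sigma(\widehat W)$ be the $\sigma$-field generated by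 $(\widehat W^k_t)_{t\in[0,T],\,1\le k\le d}$. Then, $\mathbb P$-a.s., for every $i\neq j$ in $\{1,\ldots,d\}$ and every $0\le s\le t\le T$, \[ \mathbb E\left(\int_s^t (W^i_u-W^i_s)\,dW^j_u\,\Big|\,\sigma(\widehat W)\right)=\int_s^t(\widehat W^i_u-\widehat W^i_s)\,d\widehat W^j_u . \] Here the integral on the left is the Itô integral. The integral on the right is, pathwise, a Riemann–Stieltjes integral, whose existence almost surely for all $i\ne j$ and $s\le t$ is part of the claim. The equality for all $(s,t)$ simultaneously means that the conditional expectations on the left, which for fixed $(s,t)$ are defined up to null sets, have versions that are almost surely jointly continuous in $(s,t)\in\{0\le s\le t\le T\}$ and that, almost surely, these versions equal the right-hand side for all $i\neq j$ and all $0\le s\le t\le T$. -/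

import Mathlib

open MeasureTheory ProbabilityTheory Filter Topology Set
open scoped NNReal ENNReal

namespace BrownianQuantization

/-- `W = (W¹, …, Wᵈ)` is a standard `d`-dimensional Brownian motion with respect to the
filtration `ℱ`. (The natural filtration of `W`, augmented or not, is a possible choice.) -/
structure IsBrownianMotion {Ω : Type*} {mΩ : MeasurableSpace Ω} {d : ℕ}
    (ℱ : Filtration ℝ≥0 mΩ) (P : Measure Ω) (W : Fin d → ℝ≥0 → Ω → ℝ) : Prop where
  /-- each component is a standard real Brownian motion -/
  isBrownianReal : ∀ i, IsBrownianReal (W i) P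
  /-- the components are independent processes -/
  iIndepFun_components : iIndepFun (fun i ω (t : ℝ≥0) ↦ W i t ω) P
  adapted : ∀ i, Adapted ℱ (W i)
  /-- the increments of `W` after time `s` are independent of `ℱ s` -/
  indep_increments : ∀ s t : ℝ≥0, s ≤ t →
    Indep (ℱ s) (MeasurableSpace.comap (fun ω i ↦ W i t ω - W i s ω) inferInstance) P

/-! ### The Itô integral -/

/-- A bounded simple predictable process
`H = ∑_{k < n} ξ_k 1_{(t_k, t_{k+1}]}`, with `ξ_k` bounded and `ℱ (t_k)`-measurable. -/
structure SimpleProcess {Ω : Type*} {mΩ : MeasurableSpace Ω} (ℱ : Filtration ℝ≥0 mΩ) where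
  n : ℕ
  time : ℕ → ℝ≥0
  time_mono : Monotone time
  coef : ℕ → Ω → ℝ
  coef_measurable : ∀ k, Measurable[ℱ (time k)] (coef k)
  coef_bounded : ∃ K : ℝ, ∀ k ω, |coef k ω| ≤ K

namespace SimpleProcess

variable {Ω : Type*} {mΩ : MeasurableSpace Ω} {ℱ : Filtration ℝ≥0 mΩ}

/-- The value `H_u(ω)` of a simple process. -/
noncomputable def value (H : SimpleProcess ℱ) (u : ℝ≥0) (ω : Ω) : ℝ :=
  ∑ k ∈ Finset.range H.n, (Ioc (H.time k) (H.time (k + 1))).indicator (fun _ ↦ H.coef k ω) u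

/-- The elementary stochastic integral
`∫_s^t H dB = ∑_k ξ_k (B_{(t_{k+1} ∧ t) ∨ s} - B_{(t_k ∧ t) ∨ s})`, for `s ≤ t`. -/
noncomputable def integral (H : SimpleProcess ℱ) (B : ℝ≥0 → Ω → ℝ) (s t : ℝ≥0) (ω : Ω) : ℝ :=
  ∑ k ∈ Finset.range H.n,
    H.coef k ω * (B (max s (min (H.time (k + 1)) t)) ω - B (max s (min (H.time k) t)) ω)

end SimpleProcess

/-- The random variable `X` is (a version of) the Itô integral `∫_s^t φ_u dB_u` with respect to the
`ℱ`-Brownian motion `B`: it is the `L²(P)`-limit of the elementary stochastic integrals of simple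
processes `H n` which converge to `φ` in `L²(Ω × (s, t], P ⊗ du)`. -/
def IsItoIntegral {Ω : Type*} {mΩ : MeasurableSpace Ω} (ℱ : Filtration ℝ≥0 mΩ) (P : Measure Ω)
    (B φ : ℝ≥0 → Ω → ℝ) (s t : ℝ≥0) (X : Ω → ℝ) : Prop :=
  MemLp X 2 P ∧ ∃ H : ℕ → SimpleProcess ℱ,
    Tendsto (fun n ↦ ∫⁻ ω, (∫⁻ u in Ioc (s : ℝ) (t : ℝ),
      ‖(H n).value u.toNNReal ω - φ u.toNNReal ω‖ₑ ^ 2) ∂P) atTop (𝓝 0) ∧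
    Tendsto (fun n ↦ eLpNorm (fun ω ↦ (H n).integral B s t ω - X ω) 2 P) atTop (𝓝 0)

/-! ### The Stieltjes integral -/

/-- `J` is the Stieltjes integral `∫_s^t f dg`, for `s ≤ t`: the Riemann–Stieltjes sums
`∑_k f(ξ_k) (g(p_{k+1}) - g(p_k))` over the tagged subdivisions `s = p_0 ≤ ⋯ ≤ p_n = t`,
`p_k ≤ ξ_k ≤ p_{k+1}`, tend to `J` as the mesh of the subdivision tends to `0`. -/
def HasStieltjesIntegral (f g : ℝ≥0 → ℝ) (s t : ℝ≥0) (J : ℝ) : Prop :=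
  ∀ ε : ℝ, 0 < ε → ∃ δ : ℝ, 0 < δ ∧
    ∀ (n : ℕ) (p ξ : ℕ → ℝ≥0), p 0 = s → p n = t →
      (∀ k < n, p k ≤ ξ k ∧ ξ k ≤ p (k + 1) ∧ (p (k + 1) : ℝ) - p k < δ) →
      |∑ k ∈ Finset.range n, f (ξ k) * (g (p (k + 1)) - g (p k)) - J| < ε

/-! ### Functional quantization -/

/-- The Hilbert space `L²([0, T], dt)`. -/
abbrev PathL2 (T : ℝ≥0) : Type :=
  Lp ℝ 2 ((volume : Measure ℝ).restrict (Icc (0 : ℝ) (T : ℝ)))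

open Classical in
/-- The class in `L²([0, T], dt)` of a path `x` (which is `0` if `x` is not
square integrable on `[0, T]`). -/
noncomputable def pathClass (T : ℝ≥0) (x : ℝ≥0 → ℝ) : PathL2 T :=
  if h : MemLp (fun u : ℝ ↦ x u.toNNReal) 2 ((volume : Measure ℝ).restrict (Icc (0 : ℝ) (T : ℝ)))
  then h.toLp else 0

/-- The σ-field generated by the process `(X_t)_{t ∈ [0, T]}`. -/
abbrev pathSigma {Ω : Type*} (T : ℝ≥0) (X : ℝ≥0 → Ω → ℝ) : MeasurableSpace Ω :=
  ⨆ t ∈ Iic T, MeasurableSpace.comap (X t) inferInstance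

/-- `(C a)_{a ∈ α}` is a Voronoi partition of `H` induced by `α`: a Borel partition such that each
point of `C a` has `a` as a nearest point in `α`. -/
structure IsVoronoiPartition {H : Type*} [NormedAddCommGroup H] (α : Set H) (C : H → Set H) :
    Prop where
  measurableSet : ∀ a ∈ α, MeasurableSet[borel H] (C a)
  pairwiseDisjoint : α.PairwiseDisjoint C
  iUnion_eq : ⋃ a ∈ α, C a = univ
  nearest : ∀ a ∈ α, ∀ x ∈ C a, ∀ b ∈ α, ‖x - a‖ ≤ ‖x - b‖

/-- `Xhat` is a Voronoi quantization on `[0, T]` of the process `X` by the codebook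
`α ⊆ L²([0, T], dt)`: almost surely `Xhat = ∑_{a ∈ α} a 1_{X ∈ C a}` in `L²([0, T], dt)`,
where `(C a)` is a Voronoi partition induced by `α`. -/
structure IsVoronoiQuantization {Ω : Type*} {mΩ : MeasurableSpace Ω} (T : ℝ≥0) (P : Measure Ω)
    (α : Set (PathL2 T)) (X Xhat : ℝ≥0 → Ω → ℝ) : Prop where
  measurable : ∀ t ≤ T, Measurable (Xhat t)
  voronoi : ∃ C : PathL2 T → Set (PathL2 T), IsVoronoiPartition α C ∧
    ∀ᵐ ω ∂P, ∀ a ∈ α, pathClass T (fun t ↦ X t ω) ∈ C a → pathClass T (fun t ↦ Xhat t ω) = a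

/-- `Xhat` is a pathwise continuous stationary quantization of `X` by the codebook `α`:
`Xhat = E(X | σ(Xhat))` a.s., for the conditional expectation of `L²([0, T], dt)`-valued
random variables. -/
structure IsContinuousStationaryQuantization {Ω : Type*} {mΩ : MeasurableSpace Ω} (T : ℝ≥0)
    (P : Measure Ω) (α : Set (PathL2 T)) (X Xhat : ℝ≥0 → Ω → ℝ) : Prop
    extends IsVoronoiQuantization T P α X Xhat where
  continuousOn : ∀ᵐ ω ∂P, ContinuousOn (fun t ↦ Xhat t ω) (Iic T)
  stationary : (fun ω ↦ pathClass T (fun t ↦ Xhat t ω)) =ᵐ[P]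
    P[fun ω ↦ pathClass T (fun t ↦ X t ω) | pathSigma T Xhat]

end BrownianQuantization

namespace BrownianQuantization

/-! Since the codebooks are countable, `σ(Ŵ)` is purely atomic up to null sets: almost every point
lies in an atom of positive probability, the intersection of the events `B k = {Ŵᵏ = aₖ}`. The
conditional expectation is constant on such an atom, so it is enough to average the Itô integral
over it.

Two facts make this average computable. First, up to null sets `B k` is the event that `Wᵏ` falls
into a Voronoi cell, hence belongs to `σ(Wᵏ)`, and independence of the components factorises
expectations over the atom (`setIntegral_iInter_mul`). Second, stationarity says that on `B k` the
path of `Ŵᵏ` is the conditional mean `t ↦ E(Wᵏ_t | B k)`; the identity of `L²` classes holds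
pointwise because both sides are continuous
(`IsContinuousStationaryQuantization.real_fiber_mul_eq_setIntegral`).

The paths `t ↦ E(1_A B_t)` are absolutely continuous: for disjoint intervals, the sum of the
absolute values of the increments is the expectation over `A` of a signed sum of Brownian
increments, whose `L²` norm is at most the square root of the total length
(`IsFilteredBrownian.sum_abs_setIntegral_increment_le`). The right-hand side is thus a
Riemann–Stieltjes integral against an integrator with integrable density, jointly continuous in `(s,
t)`.

It remains to pass to the limit. The Itô integral is the `L²` limit of truncated left-point Riemann
sums (`IsItoIntegral.tendsto_riemannProcess`). As `i ≠ j`, their expectation over the atom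
factorises term by term into Riemann–Stieltjes sums of the mean paths, up to a truncation error that
vanishes (`setIntegral_itoIntegral`). `pathArea_ae_eq_condExp` turns this into the statement on
conditional expectations. The version is given by an explicit pathwise formula, so a single null set
serves all `(s, t)`. -/

/-! ### Continuous paths and their classes in `L²([0, T])`. -/

lemma isCompact_Iic_nnreal (T : ℝ≥0) : IsCompact (Iic T) := by
  have : Iic T = Icc 0 T := by ext; simp
  rw [this]; exact isCompact_Icc

lemma continuousOn_comp_toNNReal {T : ℝ≥0} {x : ℝ≥0 → ℝ} (hx : ContinuousOn x (Iic T)) :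
    ContinuousOn (fun u : ℝ ↦ x u.toNNReal) (Icc 0 (T : ℝ)) :=
  hx.comp continuous_real_toNNReal.continuousOn fun u hu ↦ by
    exact Real.toNNReal_le_iff_le_coe.2 hu.2

lemma memLp_comp_toNNReal {T : ℝ≥0} {x : ℝ≥0 → ℝ} (hx : ContinuousOn x (Iic T)) :
    MemLp (fun u : ℝ ↦ x u.toNNReal) 2 ((volume : Measure ℝ).restrict (Icc (0 : ℝ) (T : ℝ))) := by
  obtain ⟨C, hC⟩ := isCompact_Icc.exists_bound_of_continuousOn (continuousOn_comp_toNNReal hx)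
  refine MemLp.of_bound ((continuousOn_comp_toNNReal hx).aestronglyMeasurable measurableSet_Icc) C ?_
  filter_upwards [ae_restrict_mem measurableSet_Icc] with u hu using hC u hu

lemma coeFn_pathClass {T : ℝ≥0} {x : ℝ≥0 → ℝ} (hx : ContinuousOn x (Iic T)) :
    pathClass T x =ᵐ[(volume : Measure ℝ).restrict (Icc (0 : ℝ) (T : ℝ))]
      fun u ↦ x u.toNNReal := by
  rw [pathClass, dif_pos (memLp_comp_toNNReal hx)]
  exact MemLp.coeFn_toLp _

/-- Continuous functions that agree almost everywhere on a nondegenerate interval agree on all of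
it. For `T = 0` the measure vanishes and all classes coincide. -/
lemma eqOn_of_pathClass_eq {T : ℝ≥0} (hT : 0 < T) {x y : ℝ≥0 → ℝ} (hx : ContinuousOn x (Iic T))
    (hy : ContinuousOn y (Iic T)) (h : pathClass T x = pathClass T y) : EqOn x y (Iic T) := by
  have h1 : (fun u : ℝ ↦ x u.toNNReal) =ᵐ[(volume : Measure ℝ).restrict (Icc (0 : ℝ) (T : ℝ))]
      fun u ↦ y u.toNNReal := by
    refine (coeFn_pathClass hx).symm.trans ?_
    rw [h]
    exact coeFn_pathClass hy
  have h2 := Measure.eqOn_Icc_of_ae_eq volume (a := 0) (b := (T : ℝ)) (by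
    exact_mod_cast hT.ne) h1
    (continuousOn_comp_toNNReal hx) (continuousOn_comp_toNNReal hy)
  intro t ht
  have := h2 (x := (t : ℝ)) ⟨t.2, by exact_mod_cast ht⟩
  simpa using this

/-! ### Stieltjes integrals against absolutely continuous integrators. -/

/-- The Stieltjes integral with respect to an integrator with density `g'`. -/
lemma hasStieltjesIntegral_of_density {T : ℝ≥0} {f g : ℝ≥0 → ℝ} {g' : ℝ → ℝ}
    (hf : ContinuousOn f (Iic T)) (hg' : IntervalIntegrable g' volume 0 T)
    (hg : ∀ a b : ℝ≥0, a ≤ b → b ≤ T → ∫ u in (a : ℝ)..b, g' u = g b - g a)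
    {s t : ℝ≥0} (htT : t ≤ T) :
    HasStieltjesIntegral f g s t (∫ u in (s : ℝ)..t, f u.toNNReal * g' u) := by
  intro ε hε
  set M := ∫ u in (0 : ℝ)..T, |g' u| with hM
  have hM0 : 0 ≤ M := intervalIntegral.integral_nonneg T.2 fun u _ ↦ abs_nonneg _
  -- `M` bounds the variation of `g`, so an oscillation of `f` below `ε / (M + 1)` on each cell
  -- gives a total error below `ε`; the `+ 1` covers `M = 0`.
  obtain ⟨δ, hδ, hunif⟩ := Metric.uniformContinuousOn_iff.1
    ((isCompact_Iic_nnreal T).uniformContinuousOn_of_continuous hf) (ε / (M + 1)) (by positivity)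
  refine ⟨δ, hδ, fun n p ξ hp0 hpn hp ↦ ?_⟩
  have hstep : ∀ k < n, p k ≤ p (k + 1) := fun k hk ↦ (hp k hk).1.trans (hp k hk).2.1
  have hle : ∀ k ≤ n, p k ≤ t := by
    intro k hk
    rw [← hpn]
    induction hk using Nat.decreasingInduction with
    | self => exact le_rfl
    | of_succ k hk ih => exact (hstep k hk).trans ih
  have hge : ∀ k ≤ n, s ≤ p k := by
    intro k
    rw [← hp0]
    induction k with
    | zero => intro _; exact le_rfl
    | succ k ih => intro hk; exact (ih (by omega)).trans (hstep k hk)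
  have hint : ∀ a b : ℝ≥0, a ≤ T → b ≤ T → IntervalIntegrable g' volume (a : ℝ) b := by
    intro a b ha hb
    refine hg'.mono_set ?_
    rw [uIcc_of_le T.coe_nonneg]
    exact uIcc_subset_Icc ⟨a.2, by exact_mod_cast ha⟩ ⟨b.2, by exact_mod_cast hb⟩
  have hfint : ∀ a b : ℝ≥0, a ≤ T → b ≤ T →
      IntervalIntegrable (fun u ↦ f u.toNNReal * g' u) volume (a : ℝ) b := by
    intro a b ha hb
    refine (hint a b ha hb).continuousOn_mul ((continuousOn_comp_toNNReal hf).mono ?_)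
    exact uIcc_subset_Icc ⟨a.2, by exact_mod_cast ha⟩ ⟨b.2, by exact_mod_cast hb⟩
  have hpT : ∀ k ≤ n, p k ≤ T := fun k hk ↦ (hle k hk).trans htT
  have hJ : ∫ u in (s : ℝ)..t, f u.toNNReal * g' u =
      ∑ k ∈ Finset.range n, ∫ u in (p k : ℝ)..p (k + 1), f u.toNNReal * g' u := by
    rw [intervalIntegral.sum_integral_adjacent_intervals (a := fun k ↦ (p k : ℝ)) (fun k hk ↦
      hfint _ _ (hpT k hk.le) (hpT (k + 1) hk)), hp0, hpn]
  have hMle : ∑ k ∈ Finset.range n, ∫ u in (p k : ℝ)..p (k + 1), |g' u| ≤ M := by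
    rw [intervalIntegral.sum_integral_adjacent_intervals (a := fun k ↦ (p k : ℝ)) (fun k hk ↦
      (hint _ _ (hpT k hk.le) (hpT (k + 1) hk)).abs)]
    refine intervalIntegral.integral_mono_interval (p 0).2 ?_ ?_ ?_ hg'.abs
    · exact_mod_cast (hp0 ▸ hge n le_rfl)
    · exact_mod_cast hpT n le_rfl
    · exact Eventually.of_forall fun u ↦ abs_nonneg _
  rw [hJ, ← Finset.sum_sub_distrib]
  calc |∑ k ∈ Finset.range n, (f (ξ k) * (g (p (k + 1)) - g (p k)) -
        ∫ u in (p k : ℝ)..p (k + 1), f u.toNNReal * g' u)|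
      ≤ ∑ k ∈ Finset.range n, |f (ξ k) * (g (p (k + 1)) - g (p k)) -
        ∫ u in (p k : ℝ)..p (k + 1), f u.toNNReal * g' u| := Finset.abs_sum_le_sum_abs _ _
    _ ≤ ∑ k ∈ Finset.range n, ε / (M + 1) * ∫ u in (p k : ℝ)..p (k + 1), |g' u| := by
        refine Finset.sum_le_sum fun k hk ↦ ?_
        have hk := Finset.mem_range.1 hk
        have hk0 := hpT k hk.le
        have hk1 := hpT (k + 1) hk
        rw [← hg _ _ (hstep k hk) hk1, ← intervalIntegral.integral_const_mul,
          ← intervalIntegral.integral_const_mul, ← intervalIntegral.integral_sub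
            ((hint _ _ hk0 hk1).const_mul _) (hfint _ _ hk0 hk1), ← Real.norm_eq_abs]
        have hkr : (p k : ℝ) ≤ p (k + 1) := by exact_mod_cast hstep k hk
        refine intervalIntegral.norm_integral_le_of_norm_le hkr ?_
          ((hint _ _ hk0 hk1).abs.const_mul _)
        refine Eventually.of_forall fun u hu ↦ ?_
        rw [← sub_mul, norm_mul, Real.norm_eq_abs, Real.norm_eq_abs]
        gcongr
        have h1 : u.toNNReal ≤ p (k + 1) := Real.toNNReal_le_iff_le_coe.2 hu.2
        have h2 : p k ≤ u.toNNReal := (Real.le_toNNReal_iff_coe_le ((p k).2.trans hu.1.le)).2 hu.1.le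
        have := (hp k hk).1
        have := (hp k hk).2.1
        have h3 := (hp k hk).2.2
        rw [← Real.dist_eq]
        refine (hunif _ (mem_Iic.2 (by order)) _ (mem_Iic.2 (by order)) ?_).le
        rw [NNReal.dist_eq]
        have e1 : (u.toNNReal : ℝ) ≤ p (k + 1) := by exact_mod_cast h1
        have e2 : (p k : ℝ) ≤ u.toNNReal := by exact_mod_cast h2
        have e3 : (p k : ℝ) ≤ ξ k := by exact_mod_cast (hp k hk).1
        have e4 : (ξ k : ℝ) ≤ p (k + 1) := by exact_mod_cast (hp k hk).2.1
        rw [abs_lt]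
        constructor <;> linarith
    _ = ε / (M + 1) * ∑ k ∈ Finset.range n, ∫ u in (p k : ℝ)..p (k + 1), |g' u| := by
        rw [Finset.mul_sum]
    _ ≤ ε / (M + 1) * M := by gcongr
    _ < ε := by
        rw [div_mul_eq_mul_div, div_lt_iff₀ (by positivity)]
        nlinarith

/-- The area process `∫_s^t (f u - f s) dg u` is jointly continuous. -/
lemma continuousOn_area {T : ℝ≥0} {f : ℝ≥0 → ℝ} {g' : ℝ → ℝ}
    (hf : ContinuousOn f (Iic T)) (hg' : IntervalIntegrable g' volume 0 T) :
    ContinuousOn (fun p : ℝ≥0 × ℝ≥0 ↦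
      ∫ u in (p.1 : ℝ)..p.2, (f u.toNNReal - f p.1) * g' u) {p | p.1 ≤ p.2 ∧ p.2 ≤ T} := by
  have hint : ∀ a b : ℝ≥0, a ≤ T → b ≤ T → uIcc (a : ℝ) b ⊆ Icc 0 T := fun a b ha hb ↦
    uIcc_subset_Icc ⟨a.2, by exact_mod_cast ha⟩ ⟨b.2, by exact_mod_cast hb⟩
  have hfg : IntervalIntegrable (fun u ↦ f u.toNNReal * g' u) volume 0 T :=
    hg'.continuousOn_mul (by rw [uIcc_of_le T.coe_nonneg]; exact continuousOn_comp_toNNReal hf)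
  have hprim : ∀ h : ℝ → ℝ, IntervalIntegrable h volume 0 T →
      ContinuousOn (fun t : ℝ≥0 ↦ ∫ u in (0 : ℝ)..t, h u) (Iic T) := by
    intro h hh
    have := intervalIntegral.continuousOn_primitive_interval (a := 0) (b := T) (μ := volume)
      (f := h) (by
        rw [uIcc_of_le T.coe_nonneg]
        exact (intervalIntegrable_iff_integrableOn_Icc_of_le T.2).1 hh)
    rw [uIcc_of_le T.coe_nonneg] at this
    exact this.comp NNReal.continuous_coe.continuousOn fun t ht ↦ ⟨t.2, by exact_mod_cast ht⟩
  have hfst : MapsTo (Prod.fst : ℝ≥0 × ℝ≥0 → ℝ≥0) {p | p.1 ≤ p.2 ∧ p.2 ≤ T} (Iic T) :=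
    fun p hp ↦ hp.1.trans hp.2
  have hsnd : MapsTo (Prod.snd : ℝ≥0 × ℝ≥0 → ℝ≥0) {p | p.1 ≤ p.2 ∧ p.2 ≤ T} (Iic T) :=
    fun p hp ↦ hp.2
  -- The area is a combination of the primitives of `f g'` and of `g'`, each continuous in its
  -- endpoint.
  have hc : ContinuousOn (fun p : ℝ≥0 × ℝ≥0 ↦
      ((∫ u in (0 : ℝ)..p.2, f u.toNNReal * g' u) - ∫ u in (0 : ℝ)..p.1, f u.toNNReal * g' u) -
      f p.1 * ((∫ u in (0 : ℝ)..p.2, g' u) - ∫ u in (0 : ℝ)..p.1, g' u))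
      {p | p.1 ≤ p.2 ∧ p.2 ≤ T} := by
    have h1 := (hprim _ hfg).comp continuousOn_fst hfst
    have h2 := (hprim _ hfg).comp continuousOn_snd hsnd
    have h3 := (hprim _ hg').comp continuousOn_fst hfst
    have h4 := (hprim _ hg').comp continuousOn_snd hsnd
    have h5 := hf.comp continuousOn_fst hfst
    exact (h2.sub h1).sub (h5.mul (h4.sub h3))
  refine hc.congr fun p hp ↦ ?_
  have hsub : ∀ a b : ℝ≥0, a ≤ T → b ≤ T → ∀ h : ℝ → ℝ, IntervalIntegrable h volume 0 T →
      IntervalIntegrable h volume a b := fun a b ha hb h hh ↦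
    hh.mono_set (by rw [uIcc_of_le T.coe_nonneg]; exact hint a b ha hb)
  have hp1 : p.1 ≤ T := hp.1.trans hp.2
  have e : ∀ h : ℝ → ℝ, IntervalIntegrable h volume 0 T →
      (∫ u in (0 : ℝ)..p.2, h u) - ∫ u in (0 : ℝ)..p.1, h u = ∫ u in (p.1 : ℝ)..p.2, h u := by
    intro h hh
    refine intervalIntegral.integral_interval_sub_left ?_ ?_
    · simpa using hsub 0 p.2 zero_le hp.2 h hh
    · simpa using hsub 0 p.1 zero_le hp1 h hh
  simp only [sub_mul]
  rw [e _ hfg, e _ hg', intervalIntegral.integral_sub (hsub _ _ hp1 hp.2 _ hfg)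
    ((hsub _ _ hp1 hp.2 _ hg').const_mul _), intervalIntegral.integral_const_mul]

/-! ### Moments of Brownian increments relative to a filtration. -/

variable {Ω : Type*} {mΩ : MeasurableSpace Ω}

/-- A standard real Brownian motion with respect to a filtration. -/
structure IsFilteredBrownian (ℱ : Filtration ℝ≥0 mΩ) (P : Measure Ω) (B : ℝ≥0 → Ω → ℝ) :
    Prop where
  isBrownianReal : IsBrownianReal B P
  adapted : Adapted ℱ B
  indep_increments : ∀ s t : ℝ≥0, s ≤ t →
    Indep (ℱ s) (MeasurableSpace.comap (fun ω ↦ B t ω - B s ω) inferInstance) P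

lemma IsBrownianMotion.isFilteredBrownian {d : ℕ} {ℱ : Filtration ℝ≥0 mΩ} {P : Measure Ω}
    {W : Fin d → ℝ≥0 → Ω → ℝ} (hW : IsBrownianMotion ℱ P W) (i : Fin d) :
    IsFilteredBrownian ℱ P (W i) where
  isBrownianReal := hW.isBrownianReal i
  adapted := hW.adapted i
  indep_increments s t hst := by
    refine indep_of_indep_of_le_right (hW.indep_increments s t hst) ?_
    rintro _ ⟨A, hA, rfl⟩
    exact ⟨(fun x : Fin d → ℝ ↦ x i) ⁻¹' A, measurable_pi_apply i hA, rfl⟩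

lemma enorm_sq_eq_ofReal (x : ℝ) : ‖x‖ₑ ^ 2 = ENNReal.ofReal (x ^ 2) := by
  rw [← ofReal_norm, ← ENNReal.ofReal_pow (norm_nonneg _), Real.norm_eq_abs, sq_abs]

lemma memLp_two_increment {P : Measure Ω} {B : ℝ≥0 → Ω → ℝ} (hB : IsBrownianReal B P)
    (a b : ℝ≥0) : MemLp (fun ω ↦ B b ω - B a ω) 2 P :=
  hB.isGaussianProcess.hasGaussianLaw_sub.memLp_two

lemma integral_increment {P : Measure Ω} {B : ℝ≥0 → Ω → ℝ} (hB : IsBrownianReal B P)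
    (a b : ℝ≥0) : ∫ ω, (B b ω - B a ω) ∂P = 0 := by
  rw [integral_sub (hB.integrable_eval b) (hB.integrable_eval a), hB.integral_eval,
    hB.integral_eval, sub_zero]

lemma integral_increment_sq {P : Measure Ω} {B : ℝ≥0 → Ω → ℝ} (hB : IsBrownianReal B P)
    {a b : ℝ≥0} (hab : a ≤ b) : ∫ ω, (B b ω - B a ω) ^ 2 ∂P = b - a := by
  have h1 := hB.hasLaw_sub b a
  have h2 := h1.variance_eq
  rw [variance_id_gaussianReal, variance_eq_integral h1.aemeasurable] at h2
  have h3 : ∫ ω, (B b - B a) ω ∂P = 0 := integral_increment hB a b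
  rw [h3] at h2
  simp only [sub_zero, Pi.sub_apply] at h2
  rw [h2]
  have : (a : ℝ) ≤ b := by exact_mod_cast hab
  simp [Real.dist_eq, abs_of_nonneg (sub_nonneg.2 this)]

namespace IsFilteredBrownian

variable {ℱ : Filtration ℝ≥0 mΩ} {P : Measure Ω} {B : ℝ≥0 → Ω → ℝ}

lemma measurable (hB : IsFilteredBrownian ℱ P B) (t : ℝ≥0) : Measurable (B t) :=
  (hB.adapted t).mono (ℱ.le t) le_rfl

lemma indepFun_increment (hB : IsFilteredBrownian ℱ P B) {a b : ℝ≥0} (hab : a ≤ b)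
    {Z : Ω → ℝ} (hZ : Measurable[ℱ a] Z) : IndepFun Z (fun ω ↦ B b ω - B a ω) P :=
  (IndepFun_iff_Indep _ _ _).2 (indep_of_indep_of_le_left (hB.indep_increments a b hab) hZ.comap_le)

/-- Integrability of `Z` is not required: the product formula for independent factors survives with
the default value `0` of the integral. -/
lemma integral_mul_increment (hB : IsFilteredBrownian ℱ P B) {a b : ℝ≥0} (hab : a ≤ b)
    {Z : Ω → ℝ} (hZ : Measurable[ℱ a] Z) : ∫ ω, Z ω * (B b ω - B a ω) ∂P = 0 := by
  rw [(hB.indepFun_increment hab hZ).integral_fun_mul_eq_mul_integral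
    (hZ.mono (ℱ.le a) le_rfl).aestronglyMeasurable
    ((hB.measurable b).sub (hB.measurable a)).aestronglyMeasurable,
    integral_increment hB.isBrownianReal, mul_zero]

lemma integral_mul_increment_sq (hB : IsFilteredBrownian ℱ P B) {a b : ℝ≥0} (hab : a ≤ b)
    {Z : Ω → ℝ} (hZ : Measurable[ℱ a] Z) :
    ∫ ω, Z ω * (B b ω - B a ω) ^ 2 ∂P = (∫ ω, Z ω ∂P) * (b - a) := by
  have h := (hB.indepFun_increment hab hZ).comp measurable_id (measurable_id.pow_const 2)
  have h2 := h.integral_fun_mul_eq_mul_integral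
    (hZ.mono (ℱ.le a) le_rfl).aestronglyMeasurable
    (((hB.measurable b).sub (hB.measurable a)).pow_const 2).aestronglyMeasurable
  simp only [Function.comp_apply, id] at h2
  rw [h2, integral_increment_sq hB.isBrownianReal hab]

lemma memLp_two_mul_increment (hB : IsFilteredBrownian ℱ P B) (a b : ℝ≥0) {ξ : Ω → ℝ}
    (hξ : Measurable ξ) (hK : ∃ K : ℝ, ∀ ω, |ξ ω| ≤ K) :
    MemLp (fun ω ↦ ξ ω * (B b ω - B a ω)) 2 P := by
  obtain ⟨K, hK⟩ := hK
  have : MemLp ξ ⊤ P := memLp_top_of_bound hξ.aestronglyMeasurable K (Eventually.of_forall hK)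
  exact (memLp_two_increment hB.isBrownianReal a b).mul' this

end IsFilteredBrownian

/-! ### The Itô isometry for simple processes. -/

/-- The length of `(a, a'] ∩ (b, b']`. -/
noncomputable def overlap (a a' b b' : ℝ≥0) : ℝ :=
  max 0 ((min a' b' : ℝ≥0) - (max a b : ℝ≥0) : ℝ)

lemma overlap_comm (a a' b b' : ℝ≥0) : overlap a a' b b' = overlap b b' a a' := by
  rw [overlap, overlap, min_comm, max_comm a]

/-- Cut both intervals at the larger left end point and at the smaller right end point. In a product
over distinct pieces the later increment is centred and independent of everything else; only the
common piece survives and contributes its length. -/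
lemma IsFilteredBrownian.integral_mul_increment_mul_increment {ℱ : Filtration ℝ≥0 mΩ}
    {P : Measure Ω} {B : ℝ≥0 → Ω → ℝ} (hB : IsFilteredBrownian ℱ P B) {a a' b b' : ℝ≥0}
    (ha : a ≤ a') (hb : b ≤ b') {ξ η : Ω → ℝ} (hξ : Measurable[ℱ a] ξ) (hη : Measurable[ℱ b] η)
    (hξK : ∃ K : ℝ, ∀ ω, |ξ ω| ≤ K) (hηK : ∃ K : ℝ, ∀ ω, |η ω| ≤ K) :
    ∫ ω, (ξ ω * (B a' ω - B a ω)) * (η ω * (B b' ω - B b ω)) ∂P =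
      (∫ ω, ξ ω * η ω ∂P) * overlap a a' b b' := by
  wlog hab : a ≤ b generalizing a a' b b' ξ η
  · have := this hb ha hη hξ hηK hξK (le_of_not_ge hab)
    rw [overlap_comm]
    simpa only [mul_comm] using this
  have hξ' := hξ.mono (ℱ.le a) le_rfl
  have hη' := hη.mono (ℱ.le b) le_rfl
  have hF : ∀ {r q : ℝ≥0}, r ≤ q → Measurable[ℱ q] (B r) := fun hrq ↦
    (hB.adapted _).mono (ℱ.mono hrq) le_rfl
  have hint : ∀ r q v w : ℝ≥0,
      Integrable (fun ω ↦ (ξ ω * (B q ω - B r ω)) * (η ω * (B w ω - B v ω))) P := fun r q v w ↦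
    (hB.memLp_two_mul_increment r q hξ' hξK).integrable_mul
      (hB.memLp_two_mul_increment v w hη' hηK)
  rcases le_total a' b with h1 | h1
  · have e : ∀ ω, (ξ ω * (B a' ω - B a ω)) * (η ω * (B b' ω - B b ω)) =
        (ξ ω * (B a' ω - B a ω) * η ω) * (B b' ω - B b ω) := fun ω ↦ by ring
    have ho : overlap a a' b b' = 0 := by
      rw [overlap, max_eq_right hab, min_eq_left (h1.trans hb), max_eq_left]
      exact sub_nonpos.2 (by exact_mod_cast h1)
    simp_rw [e]
    rw [ho, mul_zero]
    exact hB.integral_mul_increment hb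
      (((hξ.mono (ℱ.mono hab) le_rfl).mul ((hF h1).sub (hF hab))).mul hη)
  have hsq : ∀ m, b ≤ m → ∫ ω, (ξ ω * (B m ω - B b ω)) * (η ω * (B m ω - B b ω)) ∂P =
      (∫ ω, ξ ω * η ω ∂P) * (m - b) := fun m hm ↦ by
    refine Eq.trans ?_ (hB.integral_mul_increment_sq hm ((hξ.mono (ℱ.mono hab) le_rfl).mul hη))
    congr 1; ext ω; ring
  -- The increment over `[v, w]` comes after all other factors, which are `ℱ v`-measurable.
  have hz : ∀ r q v w : ℝ≥0, a ≤ v → b ≤ v → r ≤ v → q ≤ v → v ≤ w →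
      ∫ ω, (ξ ω * (B q ω - B r ω)) * (η ω * (B w ω - B v ω)) ∂P = 0 := by
    intro r q v w hav hbv hrv hqv hvw
    rw [← hB.integral_mul_increment hvw (((hξ.mono (ℱ.mono hav) le_rfl).mul
      ((hF hqv).sub (hF hrv))).mul (hη.mono (ℱ.mono hbv) le_rfl))]
    congr 1; ext ω; simp only [Pi.mul_apply, Pi.sub_apply]; ring
  have hz' : ∀ r q v w : ℝ≥0, a ≤ v → b ≤ v → r ≤ v → q ≤ v → v ≤ w →
      ∫ ω, (ξ ω * (B w ω - B v ω)) * (η ω * (B q ω - B r ω)) ∂P = 0 := by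
    intro r q v w hav hbv hrv hqv hvw
    rw [← hz r q v w hav hbv hrv hqv hvw]
    congr 1; ext ω; ring
  rcases le_total b' a' with h2 | h2
  · have ho : overlap a a' b b' = b' - b := by
      rw [overlap, max_eq_right hab, min_eq_right h2, max_eq_right]
      exact sub_nonneg.2 (by exact_mod_cast hb)
    have e : ∀ ω, (ξ ω * (B a' ω - B a ω)) * (η ω * (B b' ω - B b ω)) =
        (ξ ω * (B b ω - B a ω)) * (η ω * (B b' ω - B b ω)) +
        ((ξ ω * (B b' ω - B b ω)) * (η ω * (B b' ω - B b ω)) +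
        (ξ ω * (B a' ω - B b' ω)) * (η ω * (B b' ω - B b ω))) := fun ω ↦ by ring
    simp_rw [e]
    rw [integral_add (hint _ _ _ _) ((hint _ _ _ _).fun_add (hint _ _ _ _)),
      integral_add (hint _ _ _ _) (hint _ _ _ _), hsq b' hb,
      hz a b b b' hab le_rfl hab le_rfl hb,
      hz' b b' b' a' (hab.trans hb) hb hb le_rfl h2, ho]
    ring
  · have ho : overlap a a' b b' = a' - b := by
      rw [overlap, max_eq_right hab, min_eq_left h2, max_eq_right]
      exact sub_nonneg.2 (by exact_mod_cast h1)
    have e : ∀ ω, (ξ ω * (B a' ω - B a ω)) * (η ω * (B b' ω - B b ω)) =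
        (ξ ω * (B b ω - B a ω)) * (η ω * (B a' ω - B b ω)) +
        ((ξ ω * (B a' ω - B b ω)) * (η ω * (B a' ω - B b ω)) +
        (ξ ω * (B a' ω - B a ω)) * (η ω * (B b' ω - B a' ω))) := fun ω ↦ by ring
    simp_rw [e]
    rw [integral_add (hint _ _ _ _) ((hint _ _ _ _).fun_add (hint _ _ _ _)),
      integral_add (hint _ _ _ _) (hint _ _ _ _), hsq a' h1,
      hz a b b a' hab le_rfl hab le_rfl h1,
      hz a a' a' b' ha h1 ha le_rfl h2, ho]
    ring

section Isometry

variable {ι : Type*} (S : Finset ι) (a b : ι → ℝ≥0)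

lemma IsFilteredBrownian.integral_sum_sq {ℱ : Filtration ℝ≥0 mΩ}
    {P : Measure Ω} {B : ℝ≥0 → Ω → ℝ} (hB : IsFilteredBrownian ℱ P B) (ξ : ι → Ω → ℝ)
    (hab : ∀ i ∈ S, a i ≤ b i) (hξ : ∀ i ∈ S, Measurable[ℱ (a i)] (ξ i))
    (hK : ∀ i ∈ S, ∃ K : ℝ, ∀ ω, |ξ i ω| ≤ K) :
    ∫ ω, (∑ i ∈ S, ξ i ω * (B (b i) ω - B (a i) ω)) ^ 2 ∂P =
      ∑ i ∈ S, ∑ j ∈ S, (∫ ω, ξ i ω * ξ j ω ∂P) * overlap (a i) (b i) (a j) (b j) := by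
  have hL : ∀ i ∈ S, MemLp (fun ω ↦ ξ i ω * (B (b i) ω - B (a i) ω)) 2 P := fun i hi ↦
    hB.memLp_two_mul_increment _ _ ((hξ i hi).mono (ℱ.le _) le_rfl) (hK i hi)
  simp_rw [sq, Finset.sum_mul_sum]
  rw [integral_finsetSum]
  · refine Finset.sum_congr rfl fun i hi ↦ ?_
    rw [integral_finsetSum]
    · refine Finset.sum_congr rfl fun j hj ↦ ?_
      exact hB.integral_mul_increment_mul_increment (hab i hi) (hab j hj) (hξ i hi) (hξ j hj)
        (hK i hi) (hK j hj)
    · exact fun j hj ↦ (hL i hi).integrable_mul (hL j hj)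
  · exact fun i hi ↦ integrable_finsetSum _ fun j hj ↦ (hL i hi).integrable_mul (hL j hj)

lemma toNNReal_mem_Ioc_iff {a b : ℝ≥0} {u : ℝ} :
    u.toNNReal ∈ Ioc a b ↔ u ∈ Ioc (a : ℝ) b := by
  rw [mem_Ioc, mem_Ioc, Real.lt_toNNReal_iff_coe_lt, Real.toNNReal_le_iff_le_coe]

/-- This is the same quadratic form in the overlaps as in `IsFilteredBrownian.integral_sum_sq`, with
`c i * c j` in place of its expectation; matching the two forms is the isometry. The intervals may
overlap. -/
lemma integral_sum_indicator_sq (c : ι → ℝ) {s t : ℝ≥0}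
    (hs : ∀ i ∈ S, s ≤ a i) (ht : ∀ i ∈ S, b i ≤ t) :
    ∫ u in Ioc (s : ℝ) t,
      (∑ i ∈ S, (Ioc (a i) (b i)).indicator (fun _ ↦ c i) u.toNNReal) ^ 2 =
      ∑ i ∈ S, ∑ j ∈ S, (c i * c j) * overlap (a i) (b i) (a j) (b j) := by
  have e : ∀ u ∈ Ioc (s : ℝ) t,
      (∑ i ∈ S, (Ioc (a i) (b i)).indicator (fun _ ↦ c i) u.toNNReal) ^ 2 =
      ∑ i ∈ S, ∑ j ∈ S, (Ioc ((max (a i) (a j) : ℝ≥0) : ℝ) ((min (b i) (b j) : ℝ≥0) : ℝ)).indicator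
        (fun _ ↦ c i * c j) u := by
    intro u _
    rw [sq, Finset.sum_mul_sum]
    refine Finset.sum_congr rfl fun i hi ↦ Finset.sum_congr rfl fun j hj ↦ ?_
    simp only [indicator_apply, toNNReal_mem_Ioc_iff]
    simp only [mem_Ioc, NNReal.coe_max, NNReal.coe_min,
      max_lt_iff, le_min_iff]
    by_cases h1 : (a i : ℝ) < u ∧ u ≤ b i <;> by_cases h2 : (a j : ℝ) < u ∧ u ≤ b j
    · simp [h1, h2]
    · rw [if_neg h2, mul_zero, if_neg (by tauto)]
    · rw [if_neg h1, zero_mul, if_neg (by tauto)]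
    · rw [if_neg h1, zero_mul, if_neg (by tauto)]
  have hint : ∀ i j, Integrable
      ((Ioc ((max (a i) (a j) : ℝ≥0) : ℝ) ((min (b i) (b j) : ℝ≥0) : ℝ)).indicator
        (fun _ ↦ c i * c j)) (volume.restrict (Ioc (s : ℝ) t)) := fun i j ↦
    (integrable_const _).indicator measurableSet_Ioc
  rw [setIntegral_congr_fun measurableSet_Ioc e, integral_finsetSum]
  · refine Finset.sum_congr rfl fun i hi ↦ ?_
    rw [integral_finsetSum]
    · refine Finset.sum_congr rfl fun j hj ↦ ?_
      rw [integral_indicator measurableSet_Ioc, Measure.restrict_restrict measurableSet_Ioc,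
        inter_eq_left.2, setIntegral_const, smul_eq_mul, mul_comm]
      · congr 1
        rw [Measure.real, Real.volume_Ioc, overlap, ENNReal.toReal_ofReal', max_comm]
      · refine Ioc_subset_Ioc ?_ ?_
        · exact_mod_cast (hs i hi).trans (le_max_left _ _)
        · exact_mod_cast (min_le_left _ _).trans (ht i hi)
    · exact fun j _ ↦ hint i j
  · exact fun i _ ↦ integrable_finsetSum _ fun j _ ↦ hint i j

/-- The Itô isometry for finite sums of elementary integrals. -/
lemma IsFilteredBrownian.lintegral_sum_sq {ℱ : Filtration ℝ≥0 mΩ}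
    {P : Measure Ω} [IsProbabilityMeasure P] {B : ℝ≥0 → Ω → ℝ} (hB : IsFilteredBrownian ℱ P B)
    (ξ : ι → Ω → ℝ) (hab : ∀ i ∈ S, a i ≤ b i) (hξ : ∀ i ∈ S, Measurable[ℱ (a i)] (ξ i))
    (hK : ∀ i ∈ S, ∃ K : ℝ, ∀ ω, |ξ i ω| ≤ K) {s t : ℝ≥0}
    (hs : ∀ i ∈ S, s ≤ a i) (ht : ∀ i ∈ S, b i ≤ t) :
    ∫⁻ ω, ‖∑ i ∈ S, ξ i ω * (B (b i) ω - B (a i) ω)‖ₑ ^ 2 ∂P =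
      ∫⁻ ω, (∫⁻ u in Ioc (s : ℝ) t,
        ‖∑ i ∈ S, (Ioc (a i) (b i)).indicator (fun _ ↦ ξ i ω) u.toNNReal‖ₑ ^ 2) ∂P := by
  have hξ' : ∀ i ∈ S, Measurable (ξ i) := fun i hi ↦ (hξ i hi).mono (ℱ.le _) le_rfl
  have hL : ∀ i ∈ S, MemLp (fun ω ↦ ξ i ω * (B (b i) ω - B (a i) ω)) 2 P := fun i hi ↦
    hB.memLp_two_mul_increment _ _ (hξ' i hi) (hK i hi)
  have hξL : ∀ i ∈ S, MemLp (ξ i) 2 P := fun i hi ↦ by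
    obtain ⟨K, hK⟩ := hK i hi
    exact MemLp.of_bound (hξ' i hi).aestronglyMeasurable K (Eventually.of_forall hK)
  have hξint : ∀ i ∈ S, ∀ j ∈ S, Integrable (fun ω ↦ ξ i ω * ξ j ω) P := fun i hi j hj ↦
    (hξL i hi).integrable_mul (hξL j hj)
  have hmeas : ∀ ω, Measurable fun u : ℝ ↦
      ∑ i ∈ S, (Ioc (a i) (b i)).indicator (fun _ ↦ ξ i ω) u.toNNReal := fun ω ↦
    Finset.measurable_sum _ fun i _ ↦
      (measurable_const.indicator measurableSet_Ioc).comp measurable_real_toNNReal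
  have hin : ∀ ω, ∫⁻ u in Ioc (s : ℝ) t,
        ‖∑ i ∈ S, (Ioc (a i) (b i)).indicator (fun _ ↦ ξ i ω) u.toNNReal‖ₑ ^ 2 =
      ENNReal.ofReal
        (∑ i ∈ S, ∑ j ∈ S, (ξ i ω * ξ j ω) * overlap (a i) (b i) (a j) (b j)) := by
    intro ω
    simp_rw [enorm_sq_eq_ofReal]
    rw [← integral_sum_indicator_sq S a b (fun i ↦ ξ i ω) hs ht,
      ofReal_integral_eq_lintegral_ofReal]
    · have : MemLp (fun u : ℝ ↦ ∑ i ∈ S, (Ioc (a i) (b i)).indicator (fun _ ↦ ξ i ω) u.toNNReal)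
          2 (volume.restrict (Ioc (s : ℝ) t)) := by
        refine MemLp.of_bound (hmeas ω).aestronglyMeasurable (∑ i ∈ S, |ξ i ω|)
          (Eventually.of_forall fun u ↦ (norm_sum_le _ _).trans ?_)
        exact Finset.sum_le_sum fun i _ ↦ norm_indicator_le_norm_self _ _
      exact this.integrable_sq
    · exact Eventually.of_forall fun u ↦ sq_nonneg _
  simp_rw [hin, enorm_sq_eq_ofReal]
  rw [← ofReal_integral_eq_lintegral_ofReal, ← ofReal_integral_eq_lintegral_ofReal,
    hB.integral_sum_sq S a b ξ hab hξ hK]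
  · congr 1
    rw [integral_finsetSum]
    · refine Finset.sum_congr rfl fun i hi ↦ ?_
      rw [integral_finsetSum]
      · exact Finset.sum_congr rfl fun j hj ↦ (integral_mul_const _ _).symm
      · exact fun j hj ↦ (hξint i hi j hj).mul_const _
    · exact fun i hi ↦ integrable_finsetSum _ fun j hj ↦ (hξint i hi j hj).mul_const _
  · exact integrable_finsetSum _ fun i hi ↦ integrable_finsetSum _ fun j hj ↦
      (hξint i hi j hj).mul_const _
  · refine Eventually.of_forall fun ω ↦ ?_
    simp only [Pi.zero_apply]
    rw [← integral_sum_indicator_sq S a b (fun i ↦ ξ i ω) hs ht]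
    exact integral_nonneg fun u ↦ sq_nonneg _
  · exact (memLp_finsetSum _ hL).integrable_sq
  · exact Eventually.of_forall fun u ↦ sq_nonneg _

end Isometry

namespace SimpleProcess

variable {ℱ : Filtration ℝ≥0 mΩ} (H K : SimpleProcess ℱ)

/-- The subdivision of `[s, t]` induced by a simple process. -/
noncomputable def clip (s t : ℝ≥0) (k : ℕ) : ℝ≥0 := max s (min (H.time k) t)

/-- The coefficients of a simple process, set to `0` after time `t`. -/
noncomputable def clipCoef (t : ℝ≥0) (k : ℕ) (ω : Ω) : ℝ := if H.time k ≤ t then H.coef k ω else 0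

lemma clip_le_clip_succ (s t : ℝ≥0) (k : ℕ) : H.clip s t k ≤ H.clip s t (k + 1) :=
  max_le_max le_rfl (min_le_min (H.time_mono k.le_succ) le_rfl)

lemma le_clip (s t : ℝ≥0) (k : ℕ) : s ≤ H.clip s t k := le_max_left _ _

lemma clip_le {s t : ℝ≥0} (hst : s ≤ t) (k : ℕ) : H.clip s t k ≤ t := max_le hst (min_le_right _ _)

/-- If `H.time k > t`, clipping moves the left end point to a time before `H.time k`, at which
`H.coef k` need not be measurable. The value `0` repairs this at no cost, since the clipped interval
is then empty. -/
lemma measurable_clipCoef (s t : ℝ≥0) (k : ℕ) :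
    Measurable[ℱ (H.clip s t k)] (H.clipCoef t k) := by
  unfold clipCoef
  split_ifs with h
  · refine (H.coef_measurable k).mono (ℱ.mono ?_) le_rfl
    rw [clip, min_eq_left h]
    exact le_max_right _ _
  · exact measurable_const

lemma clipCoef_bounded (t : ℝ≥0) (k : ℕ) : ∃ C : ℝ, ∀ ω, |H.clipCoef t k ω| ≤ C := by
  obtain ⟨C, hC⟩ := H.coef_bounded
  refine ⟨max C 0, fun ω ↦ ?_⟩
  unfold clipCoef
  split_ifs
  · exact (hC k ω).trans (le_max_left _ _)
  · simp

lemma integral_eq_clip (B : ℝ≥0 → Ω → ℝ) (s t : ℝ≥0) (ω : Ω) :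
    H.integral B s t ω = ∑ k ∈ Finset.range H.n,
      H.clipCoef t k ω * (B (H.clip s t (k + 1)) ω - B (H.clip s t k) ω) := by
  refine Finset.sum_congr rfl fun k _ ↦ ?_
  unfold clipCoef
  split_ifs with h
  · rfl
  · have h1 : min (H.time k) t = t := min_eq_right (le_of_not_ge h)
    have h2 : min (H.time (k + 1)) t = t :=
      min_eq_right ((le_of_not_ge h).trans (H.time_mono k.le_succ))
    rw [h1, h2, sub_self, mul_zero, zero_mul]

lemma value_eq_clip {s t u : ℝ≥0} (hu : u ∈ Ioc s t) (ω : Ω) :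
    H.value u ω = ∑ k ∈ Finset.range H.n,
      (Ioc (H.clip s t k) (H.clip s t (k + 1))).indicator (fun _ ↦ H.clipCoef t k ω) u := by
  refine Finset.sum_congr rfl fun k _ ↦ ?_
  have : u ∈ Ioc (H.time k) (H.time (k + 1)) ↔ u ∈ Ioc (H.clip s t k) (H.clip s t (k + 1)) := by
    simp only [clip, mem_Ioc, max_lt_iff, min_lt_iff, le_max_iff, le_min_iff, hu.1, hu.2,
      hu.1.not_ge, hu.2.not_gt, true_and, and_true, or_false, false_or]
  simp only [indicator_apply, this]
  split_ifs with h
  · rw [clipCoef, if_pos]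
    exact (this.2 h).1.le.trans hu.2
  · rfl

/-- The Itô isometry for the difference of two simple processes. -/
lemma lintegral_integral_sub_sq {P : Measure Ω} [IsProbabilityMeasure P] {B : ℝ≥0 → Ω → ℝ}
    (hB : IsFilteredBrownian ℱ P B) {s t : ℝ≥0} (hst : s ≤ t) :
    ∫⁻ ω, ‖H.integral B s t ω - K.integral B s t ω‖ₑ ^ 2 ∂P =
      ∫⁻ ω, (∫⁻ u in Ioc (s : ℝ) t,
        ‖H.value u.toNNReal ω - K.value u.toNNReal ω‖ₑ ^ 2) ∂P := by
  -- The difference is one family indexed by a disjoint union, the second half with opposite signs.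
  -- Overlapping intervals being allowed, no common refinement is needed.
  let S := (Finset.range H.n).disjSum (Finset.range K.n)
  let a : ℕ ⊕ ℕ → ℝ≥0 := Sum.elim (H.clip s t) (K.clip s t)
  let b : ℕ ⊕ ℕ → ℝ≥0 := Sum.elim (fun k ↦ H.clip s t (k + 1)) (fun k ↦ K.clip s t (k + 1))
  let ξ : ℕ ⊕ ℕ → Ω → ℝ := Sum.elim (H.clipCoef t) (fun k ω ↦ - K.clipCoef t k ω)
  have key := hB.lintegral_sum_sq S a b ξ (s := s) (t := t)
    (by rintro (k | k) _ <;> exact clip_le_clip_succ _ _ _ _)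
    (by
      rintro (k | k) _
      · exact H.measurable_clipCoef _ _ _
      · exact (K.measurable_clipCoef _ _ _).neg)
    (by
      rintro (k | k) _
      · exact H.clipCoef_bounded _ _
      · obtain ⟨C, hC⟩ := K.clipCoef_bounded t k
        exact ⟨C, fun ω ↦ by simpa [ξ] using hC ω⟩)
    (by rintro (k | k) _ <;> exact le_clip _ _ _ _)
    (by rintro (k | k) _ <;> exact clip_le _ hst _)
  refine Eq.trans (lintegral_congr fun ω ↦ ?_) (key.trans (lintegral_congr fun ω ↦ ?_))
  · rw [Finset.sum_disjSum, integral_eq_clip, integral_eq_clip]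
    simp [a, b, ξ, sub_eq_add_neg]
  · refine setLIntegral_congr_fun measurableSet_Ioc fun u hu ↦ ?_
    have hu' : u.toNNReal ∈ Ioc s t := toNNReal_mem_Ioc_iff.2 hu
    have hneg : ∀ k, (Ioc (K.clip s t k) (K.clip s t (k + 1))).indicator
        (fun _ ↦ - K.clipCoef t k ω) u.toNNReal =
        - (Ioc (K.clip s t k) (K.clip s t (k + 1))).indicator
        (fun _ ↦ K.clipCoef t k ω) u.toNNReal := fun k ↦ by
      simp only [indicator_apply]; split_ifs <;> simp
    rw [Finset.sum_disjSum, H.value_eq_clip hu', K.value_eq_clip hu']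
    simp only [a, b, ξ, Sum.elim_inl, Sum.elim_inr, hneg, Finset.sum_neg_distrib, sub_eq_add_neg]

end SimpleProcess

/-! ### Measurable versions, fourth moments and truncation. -/

lemma eLpNorm_two_eq {P : Measure Ω} (f : Ω → ℝ) :
    eLpNorm f 2 P = (∫⁻ ω, ‖f ω‖ₑ ^ 2 ∂P) ^ (1 / 2 : ℝ) := by
  rw [eLpNorm_eq_lintegral_rpow_enorm_toReal (by norm_num) (by norm_num)]
  simp

lemma enorm_sub_sq_le (x y z : ℝ) : ‖x - z‖ₑ ^ 2 ≤ 2 * ‖x - y‖ₑ ^ 2 + 2 * ‖z - y‖ₑ ^ 2 := by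
  have h2 : (2 : ℝ≥0∞) = ENNReal.ofReal 2 := by simp
  simp_rw [enorm_sq_eq_ofReal]
  rw [h2, ← ENNReal.ofReal_mul (by norm_num), ← ENNReal.ofReal_mul (by norm_num),
    ← ENNReal.ofReal_add (by positivity) (by positivity)]
  exact ENNReal.ofReal_le_ofReal (by nlinarith [sq_nonneg (x - y + (z - y))])

/-- A process with almost surely continuous paths is indistinguishable from a jointly measurable
process. -/
lemma exists_measurable_uncurry {P : Measure Ω} {B : ℝ≥0 → Ω → ℝ} (hm : ∀ t, Measurable (B t))
    (hc : ∀ᵐ ω ∂P, Continuous (B · ω)) :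
    ∃ V : ℝ → Ω → ℝ, Measurable (Function.uncurry V) ∧
      ∀ᵐ ω ∂P, ∀ u, V u ω = B u.toNNReal ω := by
  -- Setting the process to `0` on a measurable null set `N` makes every path continuous, and
  -- continuity in time with measurability in `ω` gives joint measurability.
  obtain ⟨N, hN, hNm, hN0⟩ := exists_measurable_superset_of_null (ae_iff.1 hc)
  refine ⟨fun u ↦ Nᶜ.indicator (B u.toNNReal), ?_, ?_⟩
  · refine measurable_uncurry_of_continuous_of_measurable (fun ω ↦ ?_) fun u ↦
      (hm _).indicator hNm.compl
    by_cases hω : ω ∈ N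
    · simpa [indicator, hω] using continuous_const
    · have : Continuous (B · ω) := by
        by_contra h; exact hω (hN h)
      simpa [indicator, hω, Function.comp_def] using this.comp continuous_real_toNNReal
  · have : ∀ᵐ ω ∂P, ω ∉ N := measure_eq_zero_iff_ae_notMem.1 hN0
    filter_upwards [this] with ω hω u
    simp [hω]

/-- The fourth moment of the standard Gaussian law. -/
noncomputable def gaussianFourthMoment : ℝ := ∫ x, x ^ 4 ∂(gaussianReal 0 1)

lemma gaussianFourthMoment_nonneg : 0 ≤ gaussianFourthMoment :=
  integral_nonneg fun x ↦ by positivity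

lemma integrable_pow_four_gaussianReal (v : ℝ≥0) :
    Integrable (fun x : ℝ ↦ x ^ 4) (gaussianReal 0 v) := by
  have h := (memLp_id_gaussianReal (μ := 0) (v := v) 4)
  have h2 := MemLp.integrable_norm_pow (p := 4) (by exact_mod_cast h) (by norm_num)
  refine h2.congr (Eventually.of_forall fun x ↦ ?_)
  simp only [id, Real.norm_eq_abs]
  exact Even.pow_abs (by decide) x

/-- By scaling with `√v`. The numerical value of the moment is irrelevant below; only this
homogeneity is used. -/
lemma integral_pow_four_gaussianReal (v : ℝ≥0) :
    ∫ x, x ^ 4 ∂(gaussianReal 0 v) = gaussianFourthMoment * (v : ℝ) ^ 2 := by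
  have h := gaussianReal_map_const_mul (μ := 0) (v := 1) (√(v : ℝ))
  have e : gaussianReal 0 v = (gaussianReal 0 1).map (fun x ↦ √(v : ℝ) * x) := by
    rw [h, mul_zero, mul_one]
    congr 1
    ext
    simp
  rw [e, integral_map (by fun_prop) (by fun_prop), gaussianFourthMoment, ← integral_mul_const]
  congr 1
  ext x
  have : √(v : ℝ) ^ 4 = (v : ℝ) ^ 2 := by
    rw [show (4 : ℕ) = 2 * 2 by norm_num, pow_mul, Real.sq_sqrt v.coe_nonneg]
  rw [mul_pow, this]; ring

lemma integrable_increment_pow_four {P : Measure Ω} {B : ℝ≥0 → Ω → ℝ} (hB : IsBrownianReal B P)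
    (a b : ℝ≥0) : Integrable (fun ω ↦ (B b ω - B a ω) ^ 4) P := by
  have h := hB.hasLaw_sub b a
  have h2 := integrable_pow_four_gaussianReal (nndist b.1 a.1)
  rw [← h.map_eq, integrable_map_measure (by fun_prop) h.aemeasurable] at h2
  exact h2

lemma integral_increment_pow_four {P : Measure Ω} {B : ℝ≥0 → Ω → ℝ} (hB : IsBrownianReal B P)
    {a b : ℝ≥0} (hab : a ≤ b) :
    ∫ ω, (B b ω - B a ω) ^ 4 ∂P = gaussianFourthMoment * ((b : ℝ) - a) ^ 2 := by
  have h := (hB.hasLaw_sub b a).integral_comp (f := fun x : ℝ ↦ x ^ 4) (by fun_prop)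
  have hab' : (a : ℝ) ≤ b := by exact_mod_cast hab
  rw [integral_pow_four_gaussianReal, coe_nndist, Real.dist_eq] at h
  erw [abs_of_nonneg (sub_nonneg.2 hab')] at h
  exact h

/-- Truncation to `[-c, c]`. -/
noncomputable def trunc (c x : ℝ) : ℝ := max (-c) (min c x)

lemma measurable_trunc (c : ℝ) : Measurable (trunc c) := by
  unfold trunc; fun_prop

lemma abs_trunc_le {c : ℝ} (hc : 0 ≤ c) (x : ℝ) : |trunc c x| ≤ c := by
  rw [abs_le, trunc]
  exact ⟨le_max_left _ _, max_le (by linarith) (min_le_left _ _)⟩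

/-- The error vanishes for `|x| ≤ c`; otherwise it is at most `|x|`, and `|x| ≤ x ^ 2 / c`. -/
lemma abs_trunc_sub_le {c : ℝ} (hc : 0 < c) (x : ℝ) : |trunc c x - x| ≤ x ^ 2 / c := by
  rw [le_div_iff₀ hc, trunc]
  rcases le_total x (-c) with h | h
  · rw [min_eq_right (by linarith), max_eq_left h, abs_of_nonneg (by linarith)]
    nlinarith
  rcases le_total x c with h' | h'
  · rw [min_eq_right h', max_eq_right h, sub_self, abs_zero, zero_mul]
    positivity
  · rw [min_eq_left h', max_eq_right (by linarith), abs_of_nonpos (by linarith)]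
    nlinarith

lemma sum_indicator_Ioc_eq {p : ℕ → ℝ≥0} (hp : Monotone p) (c : ℕ → ℝ) {n k : ℕ} (hk : k < n)
    {u : ℝ≥0} (hu : u ∈ Ioc (p k) (p (k + 1))) :
    ∑ j ∈ Finset.range n, (Ioc (p j) (p (j + 1))).indicator (fun _ ↦ c j) u = c k := by
  rw [Finset.sum_eq_single_of_mem k (Finset.mem_range.2 hk), indicator_of_mem hu]
  intro j _ hj
  refine indicator_of_notMem (fun hj' ↦ ?_) _
  rcases lt_or_gt_of_ne hj with h | h
  · exact (hu.1.trans_le (hj'.2.trans (hp (Nat.succ_le_of_lt h)))).false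
  · exact (hj'.1.trans_le (hu.2.trans (hp (Nat.succ_le_of_lt h)))).false

lemma exists_mem_Ioc_succ (p : ℕ → ℝ≥0) {n : ℕ} {u : ℝ≥0} (hu : u ∈ Ioc (p 0) (p n)) :
    ∃ k < n, u ∈ Ioc (p k) (p (k + 1)) := by
  classical
  have hex : ∃ k, u ≤ p k := ⟨n, hu.2⟩
  have h0 : Nat.find hex ≠ 0 := fun h ↦ by
    have := Nat.find_spec hex
    rw [h] at this
    exact this.not_gt hu.1
  obtain ⟨k, hk⟩ := Nat.exists_eq_succ_of_ne_zero h0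
  refine ⟨k, ?_, ?_, ?_⟩
  · have := Nat.find_min' hex hu.2
    omega
  · exact not_le.1 (Nat.find_min hex (by omega))
  · have := Nat.find_spec hex
    rwa [hk] at this

namespace SimpleProcess

variable {ℱ : Filtration ℝ≥0 mΩ} (H K : SimpleProcess ℱ)

lemma value_eq_coef {k : ℕ} (hk : k < H.n) {u : ℝ≥0} (hu : u ∈ Ioc (H.time k) (H.time (k + 1)))
    (ω : Ω) : H.value u ω = H.coef k ω :=
  sum_indicator_Ioc_eq H.time_mono (fun k ↦ H.coef k ω) hk hu

lemma measurable_value_uncurry :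
    Measurable fun p : Ω × ℝ ↦ H.value p.2.toNNReal p.1 := by
  unfold value
  refine Finset.measurable_sum _ fun k _ ↦ ?_
  have : (fun p : Ω × ℝ ↦ (Ioc (H.time k) (H.time (k + 1))).indicator
      (fun _ ↦ H.coef k p.1) p.2.toNNReal) =
      ((fun p : Ω × ℝ ↦ p.2.toNNReal) ⁻¹' (Ioc (H.time k) (H.time (k + 1)))).indicator
        (fun p ↦ H.coef k p.1) := by
    ext p; simp [indicator]
  rw [this]
  refine Measurable.indicator ?_ ?_
  · exact ((H.coef_measurable k).mono (ℱ.le _) le_rfl).comp measurable_fst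
  · exact (measurable_real_toNNReal.comp measurable_snd) measurableSet_Ioc

lemma memLp_integral {P : Measure Ω} [IsProbabilityMeasure P] {B : ℝ≥0 → Ω → ℝ}
    (hB : IsFilteredBrownian ℱ P B) (s t : ℝ≥0) : MemLp (H.integral B s t) 2 P := by
  have : H.integral B s t = fun ω ↦ ∑ k ∈ Finset.range H.n,
      H.coef k ω * (B (max s (min (H.time (k + 1)) t)) ω - B (max s (min (H.time k) t)) ω) := rfl
  rw [this]
  obtain ⟨C, hC⟩ := H.coef_bounded
  exact memLp_finsetSum _ fun k _ ↦ hB.memLp_two_mul_increment _ _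
    ((H.coef_measurable k).mono (ℱ.le _) le_rfl) ⟨C, hC k⟩

/-- The squared `L²(P ⊗ du)` distance of a simple process to a process. -/
noncomputable def sqDist (P : Measure Ω) (φ : ℝ≥0 → Ω → ℝ) (s t : ℝ≥0) : ℝ≥0∞ :=
  ∫⁻ ω, (∫⁻ u in Ioc (s : ℝ) (t : ℝ), ‖H.value u.toNNReal ω - φ u.toNNReal ω‖ₑ ^ 2) ∂P

/-- Isometry and triangle inequality through `φ`. This one estimate yields both the existence of the
Itô integral and its independence of the approximating sequence. The jointly measurable copy `V` of
`φ` is what allows the integrals of sums to be split. -/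
lemma lintegral_integral_sub_sq_le {P : Measure Ω} [IsProbabilityMeasure P] {B φ : ℝ≥0 → Ω → ℝ}
    (hB : IsFilteredBrownian ℱ P B)
    (hφ : ∃ V : ℝ → Ω → ℝ, Measurable (Function.uncurry V) ∧
      ∀ᵐ ω ∂P, ∀ u, V u ω = φ u.toNNReal ω) {s t : ℝ≥0} (hst : s ≤ t) :
    ∫⁻ ω, ‖H.integral B s t ω - K.integral B s t ω‖ₑ ^ 2 ∂P ≤
      2 * H.sqDist P φ s t + 2 * K.sqDist P φ s t := by
  obtain ⟨V, hV, hVφ⟩ := hφ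
  have hm : ∀ L : SimpleProcess ℱ,
      Measurable fun p : Ω × ℝ ↦ ‖L.value p.2.toNNReal p.1 - V p.2 p.1‖ₑ ^ 2 := fun L ↦
    (L.measurable_value_uncurry.sub (hV.comp measurable_swap)).enorm.pow_const 2
  have hsq : ∀ L : SimpleProcess ℱ, L.sqDist P φ s t =
      ∫⁻ ω, (∫⁻ u in Ioc (s : ℝ) (t : ℝ), ‖L.value u.toNNReal ω - V u ω‖ₑ ^ 2) ∂P := by
    intro L
    refine lintegral_congr_ae ?_
    filter_upwards [hVφ] with ω hω
    simp_rw [hω]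
  rw [H.lintegral_integral_sub_sq K hB hst, hsq, hsq,
    ← lintegral_const_mul _ (hm H).lintegral_prod_right',
    ← lintegral_const_mul _ (hm K).lintegral_prod_right',
    ← lintegral_add_left ((hm H).lintegral_prod_right'.const_mul 2)]
  refine lintegral_mono fun ω ↦ ?_
  have hmH := (hm H).comp (measurable_prodMk_left (x := ω))
  have hmK := (hm K).comp (measurable_prodMk_left (x := ω))
  simp only [Function.comp_def] at hmH hmK
  rw [← lintegral_const_mul _ hmH, ← lintegral_const_mul _ hmK,
    ← lintegral_add_left (hmH.const_mul 2)]
  exact lintegral_mono fun u ↦ enorm_sub_sq_le _ _ _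

end SimpleProcess

/-! ### Riemann approximations and the Itô integral of a Brownian increment. -/

section Riemann

variable {ℱ : Filtration ℝ≥0 mΩ}

/-- The regular subdivision of `[s, t]` in `m + 1` intervals. -/
noncomputable def regularGrid (s t : ℝ≥0) (m k : ℕ) : ℝ≥0 :=
  -- The minimum freezes the grid at its last point, so that it is monotone on all of `ℕ`; with `m +
  -- 1` cells the denominator never vanishes.
  s + (t - s) * (min k (m + 1) : ℕ) / (m + 1 : ℕ)

lemma regularGrid_mono (s t : ℝ≥0) (m : ℕ) : Monotone (regularGrid s t m) := by
  intro k l hkl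
  unfold regularGrid
  have : min k (m + 1) ≤ min l (m + 1) := min_le_min hkl le_rfl
  gcongr

lemma regularGrid_zero (s t : ℝ≥0) (m : ℕ) : regularGrid s t m 0 = s := by
  simp [regularGrid]

lemma regularGrid_last {s t : ℝ≥0} (hst : s ≤ t) (m : ℕ) : regularGrid s t m (m + 1) = t := by
  have : ((m + 1 : ℕ) : ℝ≥0) ≠ 0 := by positivity
  rw [regularGrid, min_self, mul_div_assoc, div_self this, mul_one, add_tsub_cancel_of_le hst]

lemma le_regularGrid (s t : ℝ≥0) (m k : ℕ) : s ≤ regularGrid s t m k := le_self_add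

lemma regularGrid_le {s t : ℝ≥0} (hst : s ≤ t) {m k : ℕ} (hk : k ≤ m + 1) :
    regularGrid s t m k ≤ t :=
  (regularGrid_mono s t m hk).trans_eq (regularGrid_last hst m)

lemma regularGrid_succ_sub {s t : ℝ≥0} (hst : s ≤ t) {m k : ℕ} (hk : k < m + 1) :
    (regularGrid s t m (k + 1) : ℝ) - regularGrid s t m k = ((t : ℝ) - s) / (m + 1) := by
  rw [regularGrid, regularGrid, min_eq_left hk.le, min_eq_left (Nat.succ_le_of_lt hk)]
  push_cast [NNReal.coe_sub hst]
  field_simp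
  ring

/-- The truncated Riemann approximation of `u ↦ B u - B s` on `[s, t]`. -/
noncomputable def riemannProcess {B : ℝ≥0 → Ω → ℝ} (hB : Adapted ℱ B) (s t : ℝ≥0) (m : ℕ) :
    SimpleProcess ℱ where
  n := m + 1
  time := regularGrid s t m
  time_mono := regularGrid_mono s t m
  -- Simple processes are bounded and Brownian increments are not; the truncation level tends to
  -- infinity together with the number of cells.
  coef k ω := trunc (m + 1) (B (regularGrid s t m k) ω - B s ω)
  coef_measurable k := (measurable_trunc _).comp
    ((hB _).sub ((hB s).mono (ℱ.mono (le_regularGrid s t m k)) le_rfl))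
  coef_bounded := ⟨m + 1, fun _ _ ↦ abs_trunc_le (by positivity) _⟩

/-- With `r` the grid point before `u`, the error is a truncation error of `B r - B s` plus the
increment `B u - B r`. The first costs a fourth moment over the squared level, the second at most
the mesh. The bound does not depend on `u`. -/
lemma lintegral_riemannProcess_sub_sq_le {P : Measure Ω} {B : ℝ≥0 → Ω → ℝ}
    (hB : IsFilteredBrownian ℱ P B) {s t : ℝ≥0} (hst : s ≤ t) (m : ℕ) {u : ℝ≥0}
    (hu : u ∈ Ioc s t) :
    ∫⁻ ω, ‖(riemannProcess hB.adapted s t m).value u ω - (B u ω - B s ω)‖ₑ ^ 2 ∂P ≤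
      ENNReal.ofReal (2 * gaussianFourthMoment * ((t : ℝ) - s) ^ 2 / (m + 1) ^ 2 +
        2 * ((t : ℝ) - s) / (m + 1)) := by
  set R := riemannProcess hB.adapted s t m with hR
  have hlast : R.time R.n = t := regularGrid_last hst m
  have hzero : R.time 0 = s := regularGrid_zero s t m
  obtain ⟨k, hk, huk⟩ := exists_mem_Ioc_succ R.time (n := R.n) (u := u) (by rwa [hlast, hzero])
  set r := regularGrid s t m k with hr
  have hru : r ≤ u := huk.1.le
  have hsr : s ≤ r := le_regularGrid s t m k
  have hrt : r ≤ t := hru.trans hu.2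
  have hval : ∀ ω, R.value u ω = trunc (m + 1) (B r ω - B s ω) := R.value_eq_coef hk huk
  have hm1 : (0 : ℝ) < m + 1 := by positivity
  have hpt : ∀ ω, ‖R.value u ω - (B u ω - B s ω)‖ₑ ^ 2 ≤
      ENNReal.ofReal (2 / ((m : ℝ) + 1) ^ 2 * (B r ω - B s ω) ^ 4 + 2 * (B u ω - B r ω) ^ 2) := by
    intro ω
    rw [enorm_sq_eq_ofReal, hval]
    refine ENNReal.ofReal_le_ofReal ?_
    have h1 := abs_trunc_sub_le hm1 (B r ω - B s ω)
    set x := B r ω - B s ω with hx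
    set y := B u ω - B r ω with hy
    have h2 : (trunc (m + 1) x - x) ^ 2 ≤ (x ^ 2 / (m + 1)) ^ 2 := by
      rw [← sq_abs]; gcongr
    have h3 : (x ^ 2 / ((m : ℝ) + 1)) ^ 2 = 1 / ((m : ℝ) + 1) ^ 2 * x ^ 4 := by
      field_simp
    have h4 : B u ω - B s ω = x + y := by simp [hx, hy]
    rw [h3] at h2
    rw [h4, show (2 : ℝ) / ((m : ℝ) + 1) ^ 2 = 2 * (1 / ((m : ℝ) + 1) ^ 2) by ring]
    nlinarith [sq_nonneg ((trunc (m + 1) x - x) + y)]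
  refine (lintegral_mono hpt).trans ?_
  have hi1 := (integrable_increment_pow_four hB.isBrownianReal s r).const_mul
    (2 / ((m : ℝ) + 1) ^ 2)
  have hi2 := ((memLp_two_increment hB.isBrownianReal r u).integrable_sq).const_mul 2
  rw [← ofReal_integral_eq_lintegral_ofReal (hi1.fun_add hi2)
    (Eventually.of_forall fun ω ↦ by dsimp; positivity), integral_add hi1 hi2, integral_const_mul,
    integral_const_mul, integral_increment_pow_four hB.isBrownianReal hsr,
    integral_increment_sq hB.isBrownianReal hru]
  refine ENNReal.ofReal_le_ofReal (add_le_add ?_ ?_)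
  · have : (r : ℝ) ≤ t := by exact_mod_cast hrt
    have : (s : ℝ) ≤ r := by exact_mod_cast hsr
    have h4 := gaussianFourthMoment_nonneg
    have : gaussianFourthMoment * ((r : ℝ) - s) ^ 2 ≤ gaussianFourthMoment * ((t : ℝ) - s) ^ 2 := by
      gcongr
    calc 2 / ((m : ℝ) + 1) ^ 2 * (gaussianFourthMoment * ((r : ℝ) - s) ^ 2)
        ≤ 2 / ((m : ℝ) + 1) ^ 2 * (gaussianFourthMoment * ((t : ℝ) - s) ^ 2) := by gcongr
      _ = _ := by ring
  · have h1 : (u : ℝ) ≤ regularGrid s t m (k + 1) := by exact_mod_cast huk.2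
    have h2 := regularGrid_succ_sub hst (m := m) (k := k) hk
    rw [mul_div_assoc, ← h2]
    linarith

lemma exists_measurable_uncurry_increment {P : Measure Ω} {B : ℝ≥0 → Ω → ℝ}
    (hB : IsFilteredBrownian ℱ P B) (s : ℝ≥0) :
    ∃ V : ℝ → Ω → ℝ, Measurable (Function.uncurry V) ∧
      ∀ᵐ ω ∂P, ∀ u, V u ω = (fun u ω ↦ B u ω - B s ω) u.toNNReal ω := by
  refine exists_measurable_uncurry (B := fun u ω ↦ B u ω - B s ω)
    (fun u ↦ (hB.measurable u).sub (hB.measurable s)) ?_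
  filter_upwards [hB.isBrownianReal.cont] with ω hω using hω.sub continuous_const

lemma tendsto_sqDist_riemannProcess {P : Measure Ω} [IsProbabilityMeasure P] {B : ℝ≥0 → Ω → ℝ}
    (hB : IsFilteredBrownian ℱ P B) {s t : ℝ≥0} (hst : s ≤ t) :
    Tendsto (fun m ↦ (riemannProcess hB.adapted s t m).sqDist P (fun u ω ↦ B u ω - B s ω) s t)
      atTop (𝓝 0) := by
  obtain ⟨V, hV, hVφ⟩ := exists_measurable_uncurry_increment hB s
  set c : ℕ → ℝ := fun m ↦ 2 * gaussianFourthMoment * ((t : ℝ) - s) ^ 2 / (m + 1) ^ 2 +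
        2 * ((t : ℝ) - s) / (m + 1) with hc
  have hc0 : Tendsto c atTop (𝓝 0) := by
    have h1 : Tendsto (fun m : ℕ ↦ (m : ℝ) + 1) atTop atTop :=
      tendsto_atTop_add_const_right _ _ tendsto_natCast_atTop_atTop
    have h2 : Tendsto (fun m : ℕ ↦ ((m : ℝ) + 1) ^ 2) atTop atTop :=
      (tendsto_pow_atTop two_ne_zero).comp h1
    simpa using (h2.const_div_atTop (2 * gaussianFourthMoment * ((t : ℝ) - s) ^ 2)).add
      (h1.const_div_atTop (2 * ((t : ℝ) - s)))
  have hbound : ∀ m, (riemannProcess hB.adapted s t m).sqDist P (fun u ω ↦ B u ω - B s ω) s t ≤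
      ENNReal.ofReal (c m) * volume (Ioc (s : ℝ) t) := by
    intro m
    set R := riemannProcess hB.adapted s t m
    have hVu : ∀ u, ∀ᵐ ω ∂P, V u ω = B u.toNNReal ω - B s ω := fun u ↦ by
      filter_upwards [hVφ] with ω hω using hω u
    have e : R.sqDist P (fun u ω ↦ B u ω - B s ω) s t =
        ∫⁻ ω, (∫⁻ u in Ioc (s : ℝ) (t : ℝ), ‖R.value u.toNNReal ω - V u ω‖ₑ ^ 2) ∂P := by
      refine lintegral_congr_ae ?_
      filter_upwards [hVφ] with ω hω
      simp_rw [hω]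
    -- By Tonelli, the uniform bound at fixed `u` can be integrated over `(s, t]`.
    rw [e, lintegral_lintegral_swap
      ((R.measurable_value_uncurry.sub (hV.comp measurable_swap)).enorm.pow_const 2).aemeasurable,
      ← setLIntegral_const]
    refine setLIntegral_mono' measurableSet_Ioc fun u hu ↦ ?_
    have hu' : u.toNNReal ∈ Ioc s t := toNNReal_mem_Ioc_iff.2 hu
    refine le_trans (le_of_eq (lintegral_congr_ae ?_))
      (lintegral_riemannProcess_sub_sq_le hB hst m hu')
    filter_upwards [hVu u] with ω hω
    rw [hω]
  refine tendsto_of_tendsto_of_tendsto_of_le_of_le tendsto_const_nhds ?_ (fun _ ↦ zero_le) hbound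
  have h3 := ENNReal.Tendsto.mul_const (b := volume (Ioc (s : ℝ) t))
    (ENNReal.tendsto_ofReal hc0) (Or.inr (by simp))
  simpa using h3

/-- The Itô integral `∫_s^t (A u - A s) dB u` exists. -/
lemma exists_isItoIntegral {P : Measure Ω} [IsProbabilityMeasure P] {A B : ℝ≥0 → Ω → ℝ}
    (hA : IsFilteredBrownian ℱ P A) (hB : IsFilteredBrownian ℱ P B) {s t : ℝ≥0} (hst : s ≤ t) :
    ∃ X, IsItoIntegral ℱ P B (fun u ω ↦ A u ω - A s ω) s t X := by
  set R := riemannProcess hA.adapted s t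
  have hR := tendsto_sqDist_riemannProcess hA hst
  have hL : ∀ m, MemLp ((R m).integral B s t) 2 P := fun m ↦ (R m).memLp_integral hB s t
  have hcau : CauchySeq fun m ↦ (hL m).toLp := by
    rw [Lp.cauchySeq_Lp_iff_cauchySeq_eLpNorm]
    have h1 : Tendsto (fun n : ℕ × ℕ ↦ (2 * (R n.1).sqDist P (fun u ω ↦ A u ω - A s ω) s t +
        2 * (R n.2).sqDist P (fun u ω ↦ A u ω - A s ω) s t) ^ (1 / 2 : ℝ)) atTop (𝓝 0) := by
      rw [← prod_atTop_atTop_eq]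
      have h2 := ENNReal.Tendsto.const_mul (a := 2) (hR.comp (tendsto_fst (g := atTop (α := ℕ))))
        (Or.inr (by simp))
      have h3 := ENNReal.Tendsto.const_mul (a := 2) (hR.comp (tendsto_snd (f := atTop (α := ℕ))))
        (Or.inr (by simp))
      have h4 := (h2.add h3).ennrpow_const (1 / 2 : ℝ)
      simpa using h4
    refine tendsto_of_tendsto_of_tendsto_of_le_of_le tendsto_const_nhds h1 (fun _ ↦ zero_le)
      fun n ↦ ?_
    have e : eLpNorm (⇑(hL n.1).toLp - ⇑(hL n.2).toLp) 2 P =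
        eLpNorm (fun ω ↦ (R n.1).integral B s t ω - (R n.2).integral B s t ω) 2 P :=
      eLpNorm_congr_ae ((hL n.1).coeFn_toLp.sub (hL n.2).coeFn_toLp)
    beta_reduce
    rw [e, eLpNorm_two_eq]
    gcongr
    exact (R n.1).lintegral_integral_sub_sq_le (R n.2) hB
      (exists_measurable_uncurry_increment hA s) hst
  obtain ⟨X, hX⟩ := cauchySeq_tendsto_of_complete hcau
  refine ⟨X, Lp.memLp X, R, hR, ?_⟩
  rw [Lp.tendsto_Lp_iff_tendsto_eLpNorm'] at hX
  refine hX.congr fun m ↦ eLpNorm_congr_ae ((hL m).coeFn_toLp.sub (EventuallyEq.refl _ _))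

/-- Every version of the Itô integral is the limit of the truncated Riemann sums. -/
lemma IsItoIntegral.tendsto_riemannProcess {P : Measure Ω} [IsProbabilityMeasure P]
    {A B : ℝ≥0 → Ω → ℝ} (hA : IsFilteredBrownian ℱ P A) (hB : IsFilteredBrownian ℱ P B)
    {s t : ℝ≥0} (hst : s ≤ t) {X : Ω → ℝ}
    (hX : IsItoIntegral ℱ P B (fun u ω ↦ A u ω - A s ω) s t X) :
    Tendsto (fun m ↦ eLpNorm
      (fun ω ↦ (riemannProcess hA.adapted s t m).integral B s t ω - X ω) 2 P) atTop (𝓝 0) := by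
  set R := riemannProcess hA.adapted s t
  have hR := tendsto_sqDist_riemannProcess hA hst
  obtain ⟨hXL, H, hH, hHX⟩ := hX
  have hH' : Tendsto (fun m ↦ (H m).sqDist P (fun u ω ↦ A u ω - A s ω) s t) atTop (𝓝 0) := hH
  have h1 : Tendsto (fun m ↦ (2 * (R m).sqDist P (fun u ω ↦ A u ω - A s ω) s t +
      2 * (H m).sqDist P (fun u ω ↦ A u ω - A s ω) s t) ^ (1 / 2 : ℝ) +
      eLpNorm (fun ω ↦ (H m).integral B s t ω - X ω) 2 P) atTop (𝓝 0) := by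
    have h2 := ENNReal.Tendsto.const_mul (a := 2) hR (Or.inr (by simp))
    have h3 := ENNReal.Tendsto.const_mul (a := 2) hH' (Or.inr (by simp))
    have h4 := ((h2.add h3).ennrpow_const (1 / 2 : ℝ)).add hHX
    simpa using h4
  refine tendsto_of_tendsto_of_tendsto_of_le_of_le tendsto_const_nhds h1 (fun _ ↦ zero_le)
    fun m ↦ ?_
  have hRm := (R m).memLp_integral hB s t
  have hHm := (H m).memLp_integral hB s t
  have e : (fun ω ↦ (R m).integral B s t ω - X ω) =
      (fun ω ↦ (R m).integral B s t ω - (H m).integral B s t ω) +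
        fun ω ↦ (H m).integral B s t ω - X ω := by
    ext ω; simp
  beta_reduce
  rw [e]
  refine (eLpNorm_add_le (hRm.sub hHm).1 (hHm.sub hXL).1 (by norm_num)).trans
    (add_le_add ?_ le_rfl)
  rw [eLpNorm_two_eq]
  gcongr
  exact (R m).lintegral_integral_sub_sq_le (H m) hB
    (exists_measurable_uncurry_increment hA s) hst

end Riemann

/-! ### The `L²` class as a measurable function of the path. -/

/-- The `L²` class of the step function with values `x (k T / (m + 1))`. -/
noncomputable def stepClass (T : ℝ≥0) (m : ℕ) (x : ℝ≥0 → ℝ) : PathL2 T :=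
  ∑ k ∈ Finset.range (m + 1), x (regularGrid 0 T m k) •
    indicatorConstLp 2 (measurableSet_Ioc (a := (regularGrid 0 T m k : ℝ))
      (b := (regularGrid 0 T m (k + 1) : ℝ))) (measure_ne_top _ _) (1 : ℝ)

lemma coeFn_stepClass (T : ℝ≥0) (m : ℕ) (x : ℝ≥0 → ℝ) :
    ∀ᵐ u ∂(volume : Measure ℝ).restrict (Icc (0 : ℝ) (T : ℝ)), ∀ k < m + 1,
      u.toNNReal ∈ Ioc (regularGrid 0 T m k) (regularGrid 0 T m (k + 1)) →
      stepClass T m x u = x (regularGrid 0 T m k) := by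
  have h1 := Lp.coeFn_fun_finsetSum (Finset.range (m + 1)) (fun k ↦ x (regularGrid 0 T m k) •
    indicatorConstLp 2 (μ := (volume : Measure ℝ).restrict (Icc (0 : ℝ) (T : ℝ)))
      (measurableSet_Ioc (a := (regularGrid 0 T m k : ℝ))
      (b := (regularGrid 0 T m (k + 1) : ℝ))) (measure_ne_top _ _) (1 : ℝ))
  have h2 : ∀ᵐ u ∂(volume : Measure ℝ).restrict (Icc (0 : ℝ) (T : ℝ)), ∀ k : ℕ,
      (x (regularGrid 0 T m k) • indicatorConstLp 2
        (μ := (volume : Measure ℝ).restrict (Icc (0 : ℝ) (T : ℝ)))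
        (measurableSet_Ioc (a := (regularGrid 0 T m k : ℝ))
        (b := (regularGrid 0 T m (k + 1) : ℝ))) (measure_ne_top _ _) (1 : ℝ)) u =
      x (regularGrid 0 T m k) *
        (Ioc (regularGrid 0 T m k : ℝ) (regularGrid 0 T m (k + 1))).indicator (fun _ ↦ 1) u := by
    refine ae_all_iff.2 fun k ↦ ?_
    filter_upwards [Lp.coeFn_smul (x (regularGrid 0 T m k)) (indicatorConstLp 2
        (μ := (volume : Measure ℝ).restrict (Icc (0 : ℝ) (T : ℝ)))
        (measurableSet_Ioc (a := (regularGrid 0 T m k : ℝ))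
        (b := (regularGrid 0 T m (k + 1) : ℝ))) (measure_ne_top _ _) (1 : ℝ)),
      indicatorConstLp_coeFn (p := 2) (μ := (volume : Measure ℝ).restrict (Icc (0 : ℝ) (T : ℝ)))
        (hs := measurableSet_Ioc (a := (regularGrid 0 T m k : ℝ))
        (b := (regularGrid 0 T m (k + 1) : ℝ))) (hμs := measure_ne_top _ _) (c := (1 : ℝ))]
      with u hu hu'
    rw [hu, Pi.smul_apply, hu', smul_eq_mul]
  filter_upwards [h1, h2] with u hu1 hu2 k hk huk
  rw [stepClass, hu1]
  simp_rw [hu2]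
  rw [← sum_indicator_Ioc_eq (regularGrid_mono 0 T m) (fun k ↦ x (regularGrid 0 T m k)) hk huk]
  refine Finset.sum_congr rfl fun j _ ↦ ?_
  simp only [indicator_apply, toNNReal_mem_Ioc_iff]
  split_ifs <;> simp

/-- By uniform continuity. The point is that `stepClass` depends on finitely many coordinates of the
path, so its limit is measurable for the coordinate σ-field. -/
lemma tendsto_stepClass {T : ℝ≥0} {x : ℝ≥0 → ℝ} (hx : ContinuousOn x (Iic T)) :
    Tendsto (fun m ↦ stepClass T m x) atTop (𝓝 (pathClass T x)) := by
  rw [Metric.tendsto_atTop]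
  intro ε hε
  -- `M` is the square root of the total mass, the constant in the bound of the `L²` norm by the
  -- supremum norm.
  set M : ℝ := (measureUnivNNReal ((volume : Measure ℝ).restrict (Icc (0 : ℝ) (T : ℝ))) : ℝ) ^
    ((2 : ℝ≥0∞).toReal⁻¹) with hM
  have hM0 : 0 ≤ M := by positivity
  obtain ⟨δ, hδ, hunif⟩ := Metric.uniformContinuousOn_iff.1
    ((isCompact_Iic_nnreal T).uniformContinuousOn_of_continuous hx) (ε / (M + 1)) (by positivity)
  obtain ⟨N, hN⟩ := exists_nat_gt ((T : ℝ) / δ)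
  refine ⟨N, fun m hm ↦ ?_⟩
  rw [dist_eq_norm]
  refine (Lp.norm_le_of_ae_bound (C := ε / (M + 1)) (by positivity) ?_).trans_lt ?_
  · have hpos : ∀ᵐ u ∂(volume : Measure ℝ).restrict (Icc (0 : ℝ) (T : ℝ)), u ∈ Ioc (0 : ℝ) T := by
      rw [← Measure.restrict_congr_set Ioc_ae_eq_Icc]
      exact ae_restrict_mem measurableSet_Ioc
    filter_upwards [hpos, coeFn_stepClass T m x, coeFn_pathClass hx,
      Lp.coeFn_sub (stepClass T m x) (pathClass T x)] with u hu h1 h2 h3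
    have hu' : u.toNNReal ∈ Ioc 0 T := toNNReal_mem_Ioc_iff.2 (by simpa using hu)
    obtain ⟨k, hk, huk⟩ := exists_mem_Ioc_succ (regularGrid 0 T m) (n := m + 1) (u := u.toNNReal)
      (by rwa [regularGrid_zero, regularGrid_last zero_le])
    rw [h3, Pi.sub_apply, h1 k hk huk, h2, ← dist_eq_norm]
    refine (hunif _ (regularGrid_le zero_le hk.le) _ hu'.2 ?_).le
    have e1 := regularGrid_succ_sub (s := 0) (t := T) zero_le hk
    have e2 : (regularGrid 0 T m k : ℝ) ≤ u.toNNReal := by exact_mod_cast huk.1.le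
    have e3 : (u.toNNReal : ℝ) ≤ regularGrid 0 T m (k + 1) := by exact_mod_cast huk.2
    have e4 : (T : ℝ) / (m + 1) < δ := by
      have : (N : ℝ) ≤ m := by exact_mod_cast hm
      rw [div_lt_iff₀ hδ] at hN
      rw [div_lt_iff₀ (by positivity)]
      nlinarith
    rw [NNReal.dist_eq, abs_sub_comm, abs_of_nonneg (by linarith)]
    simp only [NNReal.coe_zero, sub_zero] at e1
    linarith
  · rw [← hM, mul_div_assoc', div_lt_iff₀ (by positivity)]
    nlinarith

/-- The `L²` class of a process with almost surely continuous paths is almost surely equal to a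
function which is measurable with respect to the process. -/
lemma exists_stronglyMeasurable_pathClass {P : Measure Ω} {T : ℝ≥0} {X : ℝ≥0 → Ω → ℝ}
    (hX : ∀ᵐ ω ∂P, Continuous (X · ω)) :
    ∃ g : Ω → PathL2 T,
      StronglyMeasurable[MeasurableSpace.comap (fun ω t ↦ X t ω) inferInstance] g ∧
      (fun ω ↦ pathClass T (fun t ↦ X t ω)) =ᵐ[P] g := by
  let m : MeasurableSpace Ω := MeasurableSpace.comap (fun ω t ↦ X t ω) inferInstance
  -- The limit is taken for every `ω`: its default value where there is no convergence keeps it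
  -- strongly measurable and matters only on a null set.
  refine ⟨fun ω ↦ limUnder atTop fun m ↦ stepClass T m (fun t ↦ X t ω),
    StronglyMeasurable.limUnder fun n ↦ ?_, ?_⟩
  · refine Finset.stronglyMeasurable_fun_sum _ fun k _ ↦ StronglyMeasurable.smul_const ?_ _
    refine Measurable.stronglyMeasurable ?_
    exact (measurable_pi_apply (X := fun _ : ℝ≥0 ↦ ℝ) (regularGrid 0 T n k)).comp
      (comap_measurable _)
  · filter_upwards [hX] with ω hω
    exact (tendsto_stepClass hω.continuousOn).limUnder_eq.symm

/-! ### Regularity of the mean paths `t ↦ E(1_A B_t)`. -/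

section Increments

variable {ℱ : Filtration ℝ≥0 mΩ} {P : Measure Ω} {B : ℝ≥0 → Ω → ℝ}

lemma IsFilteredBrownian.setIntegral_sub (hB : IsFilteredBrownian ℱ P B) (A : Set Ω) (a b : ℝ≥0) :
    ∫ ω in A, (B b ω - B a ω) ∂P = ∫ ω in A, B b ω ∂P - ∫ ω in A, B a ω ∂P :=
  integral_sub (hB.isBrownianReal.integrable_eval b).integrableOn
    (hB.isBrownianReal.integrable_eval a).integrableOn

lemma IsFilteredBrownian.memLp_eval (hB : IsFilteredBrownian ℱ P B) (t : ℝ≥0) : MemLp (B t) 2 P :=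
  (hB.isBrownianReal.isGaussianProcess.hasGaussianLaw_eval t).memLp_two

lemma IsFilteredBrownian.lintegral_eval_sq (hB : IsFilteredBrownian ℱ P B) (t : ℝ≥0) :
    ∫⁻ ω, ‖B t ω‖ₑ ^ 2 ∂P = t := by
  have h : ∀ᵐ ω ∂P, B t ω = B t ω - B 0 ω := by
    filter_upwards [hB.isBrownianReal.eval_zero_ae_eq_zero] with ω hω
    rw [hω, sub_zero]
  simp_rw [enorm_sq_eq_ofReal]
  rw [← ofReal_integral_eq_lintegral_ofReal (hB.memLp_eval t).integrable_sq
    (Eventually.of_forall fun ω ↦ sq_nonneg _)]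
  have : ∫ ω, B t ω ^ 2 ∂P = ∫ ω, (B t ω - B 0 ω) ^ 2 ∂P := by
    refine integral_congr_ae ?_
    filter_upwards [h] with ω hω
    rw [← hω]
  rw [this, integral_increment_sq hB.isBrownianReal zero_le]
  simp

variable [IsProbabilityMeasure P]

/-- `∑ |E(1_A (B (b i) - B (a i)))| ≤ √(∑ (b i - a i))` for disjoint intervals `(a i, b i]`. -/
lemma IsFilteredBrownian.sum_abs_setIntegral_increment_le (hB : IsFilteredBrownian ℱ P B)
    {A : Set Ω} {ι : Type*} (S : Finset ι) (a b : ι → ℝ≥0)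
    (hab : ∀ i ∈ S, a i ≤ b i)
    (hd : (S : Set ι).PairwiseDisjoint fun i ↦ Ioc (a i) (b i)) :
    ∑ i ∈ S, |∫ ω in A, (B (b i) ω - B (a i) ω) ∂P| ≤
      √(∑ i ∈ S, ((b i : ℝ) - a i)) := by
  classical
  -- With these signs the sum of absolute values is the integral over `A` of the single variable
  -- `Z`, whose second moment is at most the total length by orthogonality of the increments.
  set ε : ι → ℝ := fun i ↦ SignType.sign (∫ ω in A, (B (b i) ω - B (a i) ω) ∂P) with hε
  have hε1 : ∀ i, ε i * ε i ≤ 1 := fun i ↦ by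
    rcases lt_trichotomy (∫ ω in A, (B (b i) ω - B (a i) ω) ∂P) 0 with h | h | h <;>
      simp [hε, h]
  set Z : Ω → ℝ := fun ω ↦ ∑ i ∈ S, ε i * (B (b i) ω - B (a i) ω) with hZ
  have hL : ∀ i ∈ S, MemLp (fun ω ↦ ε i * (B (b i) ω - B (a i) ω)) 2 P := fun i _ ↦
    (memLp_two_increment hB.isBrownianReal _ _).const_mul _
  have hZL : MemLp Z 2 P := memLp_finsetSum _ hL
  have hZsq : ∫ ω, Z ω ^ 2 ∂P ≤ ∑ i ∈ S, ((b i : ℝ) - a i) := by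
    rw [hB.integral_sum_sq S a b (fun i _ ↦ ε i) hab (fun i _ ↦ measurable_const)
      (fun i _ ↦ ⟨|ε i|, fun _ ↦ le_rfl⟩)]
    refine Finset.sum_le_sum fun i hi ↦ ?_
    have hle : (a i : ℝ) ≤ b i := by exact_mod_cast hab i hi
    rw [Finset.sum_eq_single_of_mem i hi]
    · rw [overlap, min_self, max_self, max_eq_right (sub_nonneg.2 hle)]
      simp only [integral_const, probReal_univ, one_smul]
      nlinarith [hε1 i]
    · intro j hj hji
      have : overlap (a i) (b i) (a j) (b j) = 0 := by
        rw [overlap, max_eq_left]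
        refine sub_nonpos.2 ?_
        by_contra hlt
        push Not at hlt
        have hlt : max (a i) (a j) < min (b i) (b j) := by exact_mod_cast hlt
        have hdis : Disjoint (Ioc (a i) (b i)) (Ioc (a j) (b j)) := hd hi hj hji.symm
        exact Set.disjoint_left.1 hdis ⟨(le_max_left _ _).trans_lt hlt, min_le_left _ _⟩
          ⟨(le_max_right _ _).trans_lt hlt, min_le_right _ _⟩
      rw [this, mul_zero]
  have hsum : ∑ i ∈ S, |∫ ω in A, (B (b i) ω - B (a i) ω) ∂P| = ∫ ω in A, Z ω ∂P := by
    rw [hZ, integral_finsetSum]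
    · refine Finset.sum_congr rfl fun i _ ↦ ?_
      rw [integral_const_mul, hε, sign_mul_self]
    · exact fun i hi ↦ ((hL i hi).integrable (by norm_num)).integrableOn
  have hZint := hZL.integrable (by norm_num)
  -- Nonnegativity of this variance is the inequality `(E|Z|)² ≤ E Z²`.
  have hvar := variance_nonneg |Z| P
  rw [variance_eq_sub hZL.abs] at hvar
  simp only [Pi.pow_apply, Pi.abs_apply, sq_abs] at hvar
  rw [hsum]
  calc ∫ ω in A, Z ω ∂P ≤ ∫ ω in A, |Z ω| ∂P :=
        integral_mono hZint.integrableOn hZint.abs.integrableOn fun ω ↦ le_abs_self _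
    _ ≤ ∫ ω, |Z ω| ∂P :=
        setIntegral_le_integral hZint.abs (Eventually.of_forall fun ω ↦ abs_nonneg _)
    _ ≤ √(∑ i ∈ S, ((b i : ℝ) - a i)) := Real.le_sqrt_of_sq_le (by linarith)

lemma IsFilteredBrownian.dist_setIntegral_le (hB : IsFilteredBrownian ℱ P B) (A : Set Ω)
    (a b : ℝ≥0) : dist (∫ ω in A, B a ω ∂P) (∫ ω in A, B b ω ∂P) ≤ √(dist a b) := by
  wlog hab : a ≤ b generalizing a b
  · rw [dist_comm, dist_comm a]
    exact this b a (le_of_not_ge hab)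
  have h := hB.sum_abs_setIntegral_increment_le (A := A) ({()} : Finset Unit) (fun _ ↦ a)
    (fun _ ↦ b) (fun _ _ ↦ hab) (by simp)
  have hab' : (a : ℝ) ≤ b := by exact_mod_cast hab
  rw [Finset.sum_singleton, Finset.sum_singleton, hB.setIntegral_sub] at h
  rwa [dist_comm, Real.dist_eq, NNReal.dist_eq, abs_sub_comm (a : ℝ),
    abs_of_nonneg (sub_nonneg.2 hab')]

lemma IsFilteredBrownian.continuous_setIntegral (hB : IsFilteredBrownian ℱ P B) (A : Set Ω) :
    Continuous fun t ↦ ∫ ω in A, B t ω ∂P := by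
  rw [Metric.continuous_iff]
  intro b ε hε
  refine ⟨ε ^ 2, by positivity, fun a ha ↦ (hB.dist_setIntegral_le A a b).trans_lt ?_⟩
  rwa [Real.sqrt_lt' hε]

/-- The path `t ↦ E(1_A B_t)` is absolutely continuous. -/
lemma IsFilteredBrownian.absolutelyContinuousOnInterval_setIntegral
    (hB : IsFilteredBrownian ℱ P B) (A : Set Ω) (T : ℝ≥0) :
    AbsolutelyContinuousOnInterval (fun u : ℝ ↦ ∫ ω in A, B u.toNNReal ω ∂P) 0 T := by
  rw [absolutelyContinuousOnInterval_iff]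
  intro ε hε
  -- The increments are bounded by the square root of the total length, whence `ε ^ 2`. The
  -- intervals come without orientation; minima and maxima order their end points.
  refine ⟨ε ^ 2, by positivity, fun E hE hlen ↦ ?_⟩
  obtain ⟨hE1, hE2⟩ := hE
  have hpos : ∀ i ∈ Finset.range E.1, 0 ≤ min (E.2 i).1 (E.2 i).2 := fun i hi ↦ by
    have h := hE1 i hi
    rw [uIcc_of_le T.coe_nonneg] at h
    exact le_min h.1.1 h.2.1
  have h := hB.sum_abs_setIntegral_increment_le (A := A) (Finset.range E.1)
    (fun i ↦ (min (E.2 i).1 (E.2 i).2).toNNReal) (fun i ↦ (max (E.2 i).1 (E.2 i).2).toNNReal)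
    (fun i _ ↦ Real.toNNReal_le_toNNReal min_le_max) (by
      intro i hi j hj hij
      have hdis := Set.disjoint_left.1 (show Disjoint (uIoc (E.2 i).1 (E.2 i).2)
        (uIoc (E.2 j).1 (E.2 j).2) from hE2 hi hj hij)
      refine Set.disjoint_left.2 fun u hu hu' ↦ hdis (a := (u : ℝ)) ?_ ?_
      · change _ < _ ∧ _ ≤ _
        exact ⟨(Real.toNNReal_lt_iff_lt_coe (hpos i hi)).1 hu.1,
          (Real.le_toNNReal_iff_coe_le ((hpos i hi).trans min_le_max)).1 hu.2⟩
      · change _ < _ ∧ _ ≤ _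
        exact ⟨(Real.toNNReal_lt_iff_lt_coe (hpos j hj)).1 hu'.1,
          (Real.le_toNNReal_iff_coe_le ((hpos j hj).trans min_le_max)).1 hu'.2⟩)
  have e1 : ∀ i ∈ Finset.range E.1, dist (∫ ω in A, B (E.2 i).1.toNNReal ω ∂P)
      (∫ ω in A, B (E.2 i).2.toNNReal ω ∂P) =
      |∫ ω in A, (B (max (E.2 i).1 (E.2 i).2).toNNReal ω -
        B (min (E.2 i).1 (E.2 i).2).toNNReal ω) ∂P| := by
    intro i _
    rw [hB.setIntegral_sub, Real.dist_eq]
    rcases le_total (E.2 i).1 (E.2 i).2 with h | h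
    · rw [max_eq_right h, min_eq_left h, abs_sub_comm]
    · rw [max_eq_left h, min_eq_right h]
  have e2 : ∑ i ∈ Finset.range E.1, (((max (E.2 i).1 (E.2 i).2).toNNReal : ℝ) -
      (min (E.2 i).1 (E.2 i).2).toNNReal) = ∑ i ∈ Finset.range E.1, dist (E.2 i).1 (E.2 i).2 := by
    refine Finset.sum_congr rfl fun i hi ↦ ?_
    rw [Real.coe_toNNReal _ (hpos i hi), Real.coe_toNNReal _ ((hpos i hi).trans min_le_max),
      Real.dist_eq, max_sub_min_eq_abs, abs_sub_comm]
  rw [e2] at h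
  rw [Finset.sum_congr rfl e1]
  exact h.trans_lt (by rwa [Real.sqrt_lt' hε])

end Increments

/-! ### Brownian motion as an `L²([0, T])`-valued random variable. -/

section PathClass

variable {ℱ : Filtration ℝ≥0 mΩ} {P : Measure Ω} [IsProbabilityMeasure P] {B : ℝ≥0 → Ω → ℝ}

lemma IsFilteredBrownian.exists_measurable_memLp (hB : IsFilteredBrownian ℱ P B) (T : ℝ≥0) :
    ∃ V : ℝ → Ω → ℝ, Measurable (Function.uncurry V) ∧ (∀ᵐ ω ∂P, ∀ u, V u ω = B u.toNNReal ω) ∧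
      MemLp (fun p : Ω × ℝ ↦ V p.2 p.1) 2
        (P.prod ((volume : Measure ℝ).restrict (Icc (0 : ℝ) (T : ℝ)))) := by
  obtain ⟨V, hV, hVB⟩ := exists_measurable_uncurry hB.measurable hB.isBrownianReal.cont
  have hVm : Measurable fun p : Ω × ℝ ↦ V p.2 p.1 := hV.comp measurable_swap
  refine ⟨V, hV, hVB, hVm.aestronglyMeasurable, ?_⟩
  rw [eLpNorm_two_eq]
  refine ENNReal.rpow_lt_top_of_nonneg (by norm_num) (ne_of_lt ?_)
  rw [lintegral_prod_symm _ (hVm.enorm.pow_const 2).aemeasurable]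
  have h : ∀ u ∈ Icc (0 : ℝ) T, ∫⁻ ω, ‖V u ω‖ₑ ^ 2 ∂P ≤ T := by
    intro u hu
    have : ∫⁻ ω, ‖V u ω‖ₑ ^ 2 ∂P = ∫⁻ ω, ‖B u.toNNReal ω‖ₑ ^ 2 ∂P := by
      refine lintegral_congr_ae ?_
      filter_upwards [hVB] with ω hω
      rw [hω]
    rw [this, hB.lintegral_eval_sq]
    exact_mod_cast Real.toNNReal_le_iff_le_coe.2 hu.2
  refine (setLIntegral_mono' measurableSet_Icc h).trans_lt ?_
  rw [setLIntegral_const]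
  exact ENNReal.mul_lt_top (by simp) (by simp)

lemma IsFilteredBrownian.integrable_pathClass (hB : IsFilteredBrownian ℱ P B) (T : ℝ≥0) :
    Integrable (fun ω ↦ pathClass T (fun t ↦ B t ω)) P := by
  obtain ⟨g, hg, hgB⟩ := exists_stronglyMeasurable_pathClass (T := T) hB.isBrownianReal.cont
  obtain ⟨V, hV, hVB, hVL⟩ := hB.exists_measurable_memLp T
  have hle : MeasurableSpace.comap (fun ω t ↦ B t ω) inferInstance ≤ mΩ :=
    (measurable_pi_lambda _ fun t ↦ hB.measurable t).comap_le
  have hm : AEStronglyMeasurable (fun ω ↦ pathClass T (fun t ↦ B t ω)) P :=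
    ⟨g, hg.mono hle, hgB⟩
  have hL : MemLp (fun ω ↦ pathClass T (fun t ↦ B t ω)) 2 P := by
    refine ⟨hm, ?_⟩
    have h2 := hVL.2
    rw [eLpNorm_two_eq] at h2
    rw [eLpNorm_eq_lintegral_rpow_enorm_toReal (by norm_num) (by norm_num)]
    refine lt_of_eq_of_lt ?_ h2
    congr 1
    · have hVm : Measurable fun p : Ω × ℝ ↦ V p.2 p.1 := hV.comp measurable_swap
      rw [lintegral_prod _ (hVm.enorm.pow_const 2).aemeasurable]
      refine lintegral_congr_ae ?_
      filter_upwards [hVB, hB.isBrownianReal.cont] with ω h1 h3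
      rw [Lp.enorm_def, eLpNorm_two_eq, ← ENNReal.rpow_mul]
      simp only [ENNReal.toReal_ofNat, one_div, ne_eq, OfNat.ofNat_ne_zero, not_false_eq_true,
        inv_mul_cancel₀, ENNReal.rpow_one]
      refine lintegral_congr_ae ?_
      filter_upwards [coeFn_pathClass h3.continuousOn] with u hu
      rw [hu, h1]
  exact hL.integrable (by norm_num)

/-- The integral of the `L²` class of Brownian motion is the class of the integrals. -/
lemma IsFilteredBrownian.setIntegral_pathClass (hB : IsFilteredBrownian ℱ P B) (T : ℝ≥0)
    (A : Set Ω) :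
    ∫ ω in A, pathClass T (fun t ↦ B t ω) ∂P = pathClass T (fun t ↦ ∫ ω in A, B t ω ∂P) := by
  obtain ⟨V, hV, hVB, hVL⟩ := hB.exists_measurable_memLp T
  -- Testing against `f ∈ L²` reduces the vector-valued identity to Fubini for `f u * V u ω`.
  refine ext_inner_left ℝ fun f ↦ ?_
  rw [← integral_inner (hB.integrable_pathClass T).integrableOn]
  have hint : Integrable (Function.uncurry fun (ω : Ω) (u : ℝ) ↦ f u * V u ω)
      ((P.restrict A).prod ((volume : Measure ℝ).restrict (Icc (0 : ℝ) (T : ℝ)))) := by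
    have h1 := ((Lp.memLp f).comp_snd P).integrable_mul hVL
    refine h1.mono_measure ?_
    exact Measure.prod_mono Measure.restrict_le_self le_rfl
  calc ∫ ω in A, inner ℝ f (pathClass T fun t ↦ B t ω) ∂P
      = ∫ ω in A, (∫ u in Icc (0 : ℝ) T, f u * V u ω) ∂P := by
        refine integral_congr_ae (ae_restrict_of_ae ?_)
        filter_upwards [hVB, hB.isBrownianReal.cont] with ω h1 h3
        rw [L2.inner_def]
        refine integral_congr_ae ?_
        filter_upwards [coeFn_pathClass h3.continuousOn] with u hu
        rw [hu, h1]
        exact mul_comm _ _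
    _ = ∫ u in Icc (0 : ℝ) T, (∫ ω in A, f u * V u ω ∂P) := integral_integral_swap hint
    _ = inner ℝ f (pathClass T fun t ↦ ∫ ω in A, B t ω ∂P) := by
        rw [L2.inner_def]
        refine integral_congr_ae ?_
        filter_upwards [coeFn_pathClass (hB.continuous_setIntegral A).continuousOn] with u hu
        rw [hu, integral_const_mul]
        refine Eq.trans ?_ (mul_comm _ _)
        congr 1
        refine integral_congr_ae (ae_restrict_of_ae ?_)
        filter_upwards [hVB] with ω h1 using h1 u

end PathClass

/-! ### Factorisation by independence of the components. -/

/-- The σ-field generated by a process. -/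
abbrev processSigma (X : ℝ≥0 → Ω → ℝ) : MeasurableSpace Ω :=
  MeasurableSpace.comap (fun ω t ↦ X t ω) inferInstance

lemma measurable_processSigma (X : ℝ≥0 → Ω → ℝ) (t : ℝ≥0) : Measurable[processSigma X] (X t) :=
  (measurable_pi_apply (X := fun _ : ℝ≥0 ↦ ℝ) t).comp (comap_measurable _)

lemma integral_prod_indicator_mul {P : Measure Ω} [IsProbabilityMeasure P] {d : ℕ}
    {W : Fin d → ℝ≥0 → Ω → ℝ} (hm : ∀ k t, Measurable (W k t))
    (hind : iIndepFun (fun k ω (t : ℝ≥0) ↦ W k t ω) P)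
    {A : Fin d → Set Ω} (hA : ∀ k, MeasurableSet[processSigma (W k)] (A k))
    {h : Fin d → Ω → ℝ} (hh : ∀ k, Measurable[processSigma (W k)] (h k)) :
    ∫ ω in ⋂ k, A k, ∏ k, h k ω ∂P = ∏ k, ∫ ω in A k, h k ω ∂P := by
  have hle : ∀ k, processSigma (W k) ≤ mΩ := fun k ↦
    (measurable_pi_lambda _ fun t ↦ hm k t).comap_le
  have hU : ∀ k, Measurable[processSigma (W k)] ((A k).indicator (h k)) := fun k ↦
    (hh k).indicator (hA k)
  have hindU : iIndepFun (fun k ↦ (A k).indicator (h k)) P := by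
    rw [iIndepFun_iff_iIndep] at hind ⊢
    exact iIndep_of_iIndep_of_le hind fun k ↦ (hU k).comap_le
  have key := hindU.integral_fun_prod_eq_prod_integral fun k ↦
    ((hU k).mono (hle k) le_rfl).aestronglyMeasurable
  simp_rw [integral_indicator (hle _ _ (hA _))] at key
  rw [← key, ← integral_indicator (MeasurableSet.iInter fun k ↦ hle k _ (hA k))]
  congr 1
  ext ω
  by_cases hω : ω ∈ ⋂ k, A k
  · rw [indicator_of_mem hω]
    exact Finset.prod_congr rfl fun k _ ↦ (indicator_of_mem (mem_iInter.1 hω k) _).symm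
  · rw [indicator_of_notMem hω]
    obtain ⟨k, hk⟩ := by simpa using hω
    exact (Finset.prod_eq_zero (Finset.mem_univ k) (indicator_of_notMem hk _)).symm

/-- Factorisation of `E(1_{⋂ B k} F G)`, for events `B k` which only depend on `W k`. -/
lemma setIntegral_iInter_mul {P : Measure Ω} [IsProbabilityMeasure P] {d : ℕ}
    {W : Fin d → ℝ≥0 → Ω → ℝ} (hm : ∀ k t, Measurable (W k t))
    (hind : iIndepFun (fun k ω (t : ℝ≥0) ↦ W k t ω) P)
    {A B : Fin d → Set Ω} (hA : ∀ k, MeasurableSet[processSigma (W k)] (A k))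
    (hBA : ∀ k, B k =ᵐ[P] A k) {i j : Fin d} (hij : i ≠ j) {F G : Ω → ℝ}
    (hF : Measurable[processSigma (W i)] F) (hG : Measurable[processSigma (W j)] G) :
    P.real (B i) * P.real (B j) * ∫ ω in ⋂ k, B k, F ω * G ω ∂P =
      P.real (⋂ k, B k) * ((∫ ω in B i, F ω ∂P) * ∫ ω in B j, G ω ∂P) := by
  have hI : (⋂ k, B k : Set Ω) =ᵐ[P] (⋂ k, A k : Set Ω) := Filter.EventuallyEq.countable_iInter hBA
  rw [measureReal_congr (hBA i), measureReal_congr (hBA j), measureReal_congr hI,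
    setIntegral_congr_set hI, setIntegral_congr_set (hBA i), setIntegral_congr_set (hBA j)]
  have h1 := integral_prod_indicator_mul hm hind hA (h := fun _ _ ↦ 1)
    (fun k ↦ measurable_const)
  simp only [Finset.prod_const_one, integral_const, smul_eq_mul, mul_one,
    measureReal_restrict_apply_univ] at h1
  -- Components other than `i` and `j` contribute only the factors `P.real (A k)`, which occur
  -- identically in the probability of the intersection. Multiplying by the probabilities of `B i`
  -- and `B j` avoids any division.
  let h : Fin d → Ω → ℝ := fun k ↦ if k = i then F else if k = j then G else fun _ ↦ 1
  have hi : h i = F := if_pos rfl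
  have hj : h j = G := (if_neg hij.symm).trans (if_pos rfl)
  have ho : ∀ k, k ≠ i → k ≠ j → h k = fun _ ↦ 1 := fun k h1 h2 ↦
    (if_neg h1).trans (if_neg h2)
  have h2 := integral_prod_indicator_mul hm hind hA (h := h) (fun k ↦ by
    by_cases hki : k = i
    · subst hki; rwa [hi]
    by_cases hkj : k = j
    · subst hkj; rwa [hj]
    rw [ho k hki hkj]
    exact measurable_const)
  have h3 : ∀ ω, ∏ k, h k ω = F ω * G ω := fun ω ↦ by
    rw [Finset.prod_eq_mul i j hij (fun k _ hk ↦ by rw [ho k hk.1 hk.2]) (by simp) (by simp),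
      hi, hj]
  have hji : j ∈ (Finset.univ : Finset (Fin d)).erase i := by simp [hij.symm]
  have h4 : ∏ k, ∫ ω in A k, h k ω ∂P = (∫ ω in A i, F ω ∂P) * ((∫ ω in A j, G ω ∂P) *
      ∏ k ∈ ((Finset.univ : Finset (Fin d)).erase i).erase j, P.real (A k)) := by
    rw [← Finset.mul_prod_erase _ _ (Finset.mem_univ i), ← Finset.mul_prod_erase _ _ hji, hi, hj]
    congr 2
    refine Finset.prod_congr rfl fun k hk ↦ ?_
    rw [ho k (by simp_all) (by simp_all)]
    simp
  have h5 : ∏ k, P.real (A k) = P.real (A i) * (P.real (A j) *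
      ∏ k ∈ ((Finset.univ : Finset (Fin d)).erase i).erase j, P.real (A k)) := by
    rw [← Finset.mul_prod_erase _ _ (Finset.mem_univ i), ← Finset.mul_prod_erase _ _ hji]
  simp_rw [h3] at h2
  rw [h2, h1, h4, h5]
  ring

/-! ### The Itô area averaged over a product event. -/

section Riemann

variable {ℱ : Filtration ℝ≥0 mΩ} {P : Measure Ω}

lemma riemannProcess_integral {A B : ℝ≥0 → Ω → ℝ} (hA : Adapted ℱ A) {s t : ℝ≥0} (hst : s ≤ t)
    (m : ℕ) (ω : Ω) :
    (riemannProcess hA s t m).integral B s t ω = ∑ k ∈ Finset.range (m + 1),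
      trunc (m + 1) (A (regularGrid s t m k) ω - A s ω) *
        (B (regularGrid s t m (k + 1)) ω - B (regularGrid s t m k) ω) := by
  refine Finset.sum_congr rfl fun k hk ↦ ?_
  have hk := Finset.mem_range.1 hk
  have e : ∀ l ≤ m + 1, max s (min (regularGrid s t m l) t) = regularGrid s t m l := fun l hl ↦ by
    rw [min_eq_left (regularGrid_le hst hl), max_eq_right (le_regularGrid s t m l)]
  change trunc (m + 1) (A (regularGrid s t m k) ω - A s ω) *
    (B (max s (min (regularGrid s t m (k + 1)) t)) ω -
      B (max s (min (regularGrid s t m k) t)) ω) = _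
  rw [e k hk.le, e (k + 1) hk]

lemma HasStieltjesIntegral.tendsto_regularGrid {f g : ℝ≥0 → ℝ} {s t : ℝ≥0} {J : ℝ}
    (h : HasStieltjesIntegral f g s t J) (hst : s ≤ t) :
    Tendsto (fun m ↦ ∑ k ∈ Finset.range (m + 1), f (regularGrid s t m k) *
      (g (regularGrid s t m (k + 1)) - g (regularGrid s t m k))) atTop (𝓝 J) := by
  rw [Metric.tendsto_atTop]
  intro ε hε
  obtain ⟨δ, hδ, hsum⟩ := h ε hε
  obtain ⟨N, hN⟩ := exists_nat_gt (((t : ℝ) - s) / δ)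
  refine ⟨N, fun m hm ↦ ?_⟩
  rw [Real.dist_eq]
  refine hsum (m + 1) (regularGrid s t m) (regularGrid s t m) (regularGrid_zero s t m)
    (regularGrid_last hst m) fun k hk ↦ ⟨le_rfl, regularGrid_mono s t m k.le_succ, ?_⟩
  rw [regularGrid_succ_sub hst hk]
  have : (N : ℝ) ≤ m := by exact_mod_cast hm
  rw [div_lt_iff₀ hδ] at hN
  rw [div_lt_iff₀ (by positivity)]
  nlinarith

lemma sum_abs_sub_regularGrid_le {T : ℝ≥0} {g : ℝ≥0 → ℝ} {g' : ℝ → ℝ}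
    (hg' : IntervalIntegrable g' volume 0 T)
    (hg : ∀ a b : ℝ≥0, a ≤ b → b ≤ T → ∫ u in (a : ℝ)..b, g' u = g b - g a)
    {s t : ℝ≥0} (hst : s ≤ t) (htT : t ≤ T) (m : ℕ) :
    ∑ k ∈ Finset.range (m + 1), |g (regularGrid s t m (k + 1)) - g (regularGrid s t m k)| ≤
      ∫ u in (s : ℝ)..t, |g' u| := by
  have hT : ∀ k ≤ m + 1, regularGrid s t m k ≤ T := fun k hk ↦ (regularGrid_le hst hk).trans htT
  have hint : ∀ a b : ℝ≥0, a ≤ T → b ≤ T → IntervalIntegrable g' volume (a : ℝ) b := by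
    intro a b ha hb
    refine hg'.mono_set ?_
    rw [uIcc_of_le T.coe_nonneg]
    exact uIcc_subset_Icc ⟨a.2, by exact_mod_cast ha⟩ ⟨b.2, by exact_mod_cast hb⟩
  have e : ∫ u in (s : ℝ)..t, |g' u| = ∑ k ∈ Finset.range (m + 1),
      ∫ u in (regularGrid s t m k : ℝ)..regularGrid s t m (k + 1), |g' u| := by
    rw [intervalIntegral.sum_integral_adjacent_intervals (a := fun k ↦ (regularGrid s t m k : ℝ))
      (fun k hk ↦ (hint _ _ (hT k hk.le) (hT (k + 1) hk)).abs), regularGrid_zero,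
      regularGrid_last hst]
  rw [e]
  refine Finset.sum_le_sum fun k hk ↦ ?_
  have hk := Finset.mem_range.1 hk
  have hle : regularGrid s t m k ≤ regularGrid s t m (k + 1) := regularGrid_mono s t m k.le_succ
  rw [← hg _ _ hle (hT (k + 1) hk)]
  exact intervalIntegral.abs_integral_le_integral_abs (by exact_mod_cast hle)

lemma IsFilteredBrownian.abs_setIntegral_trunc_sub_le {B : ℝ≥0 → Ω → ℝ}
    (hB : IsFilteredBrownian ℱ P B) [IsProbabilityMeasure P] (A : Set Ω) {s r : ℝ≥0} (hsr : s ≤ r)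
    {c : ℝ} (hc : 0 < c) :
    |∫ ω in A, trunc c (B r ω - B s ω) ∂P - ∫ ω in A, (B r ω - B s ω) ∂P| ≤
      ((r : ℝ) - s) / c := by
  have hL := memLp_two_increment hB.isBrownianReal s r
  have hi := hL.integrable (by norm_num)
  have hti : Integrable (fun ω ↦ trunc c (B r ω - B s ω)) P :=
    Integrable.of_bound ((measurable_trunc c).comp
      ((hB.measurable r).sub (hB.measurable s))).aestronglyMeasurable c
      (Eventually.of_forall fun ω ↦ abs_trunc_le hc.le _)
  have hsq : Integrable (fun ω ↦ (B r ω - B s ω) ^ 2 / c) P := hL.integrable_sq.div_const c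
  rw [← integral_sub hti.integrableOn hi.integrableOn]
  calc |∫ ω in A, (trunc c (B r ω - B s ω) - (B r ω - B s ω)) ∂P|
      ≤ ∫ ω in A, |trunc c (B r ω - B s ω) - (B r ω - B s ω)| ∂P := abs_integral_le_integral_abs
    _ ≤ ∫ ω in A, (B r ω - B s ω) ^ 2 / c ∂P :=
        integral_mono (hti.sub hi).abs.integrableOn hsq.integrableOn fun ω ↦ abs_trunc_sub_le hc _
    _ ≤ ∫ ω, (B r ω - B s ω) ^ 2 / c ∂P :=
        setIntegral_le_integral hsq (Eventually.of_forall fun ω ↦ by dsimp; positivity)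
    _ = ((r : ℝ) - s) / c := by
        rw [integral_div, integral_increment_sq hB.isBrownianReal hsr]

/-- The expectation of the Itô integral `∫_s^t (W i - W i s) dW j` on an intersection of events
`B k`
depending only on `W k` is the Stieltjes integral of the conditional mean paths. -/
lemma setIntegral_itoIntegral [IsProbabilityMeasure P] {d : ℕ}
    {W : Fin d → ℝ≥0 → Ω → ℝ} (hW : IsBrownianMotion ℱ P W) {T : ℝ≥0}
    {A B : Fin d → Set Ω} (hA : ∀ k, MeasurableSet[processSigma (W k)] (A k))
    (hBA : ∀ k, B k =ᵐ[P] A k) {i j : Fin d} (hij : i ≠ j)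
    (hi0 : P.real (B i) ≠ 0) (hj0 : P.real (B j) ≠ 0)
    {f g : ℝ≥0 → ℝ} {g' : ℝ → ℝ} (hf : ContinuousOn f (Iic T))
    (hfB : ∀ t ≤ T, P.real (B i) * f t = ∫ ω in B i, W i t ω ∂P)
    (hgB : ∀ t ≤ T, P.real (B j) * g t = ∫ ω in B j, W j t ω ∂P)
    (hg' : IntervalIntegrable g' volume 0 T)
    (hg : ∀ a b : ℝ≥0, a ≤ b → b ≤ T → ∫ u in (a : ℝ)..b, g' u = g b - g a)
    {s t : ℝ≥0} (hst : s ≤ t) (htT : t ≤ T) {X : Ω → ℝ}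
    (hX : IsItoIntegral ℱ P (W j) (fun u ω ↦ W i u ω - W i s ω) s t X) :
    ∫ ω in ⋂ k, B k, X ω ∂P =
      P.real (⋂ k, B k) * ∫ u in (s : ℝ)..t, (f u.toNNReal - f s) * g' u := by
  have hWi := hW.isFilteredBrownian i
  have hWj := hW.isFilteredBrownian j
  set D := ⋂ k, B k with hD
  set J := ∫ u in (s : ℝ)..t, (f u.toNNReal - f s) * g' u with hJ
  set R := riemannProcess hWi.adapted s t with hR
  have hlim := hX.tendsto_riemannProcess hWi hWj hst
  have hRL : ∀ m, MemLp ((R m).integral (W j) s t) 2 P := fun m ↦ (R m).memLp_integral hWj s t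
  -- On a probability space `L²` convergence implies `L¹` convergence, hence convergence of the
  -- integrals over `D`.
  have hlim1 : Tendsto (fun m ↦ ∫ ω in D, (R m).integral (W j) s t ω ∂P) atTop
      (𝓝 (∫ ω in D, X ω ∂P)) := by
    refine tendsto_setIntegral_of_L1' X hX.1.1
      (Eventually.of_forall fun m ↦ (hRL m).integrable (by norm_num)) ?_ D
    refine tendsto_of_tendsto_of_tendsto_of_le_of_le tendsto_const_nhds hlim (fun _ ↦ zero_le)
      fun m ↦ ?_
    exact eLpNorm_le_eLpNorm_of_exponent_le (by norm_num) ((hRL m).sub hX.1).1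
  set p := regularGrid s t with hp
  have hpT : ∀ m k, k ≤ m + 1 → p m k ≤ T := fun m k hk ↦ (regularGrid_le hst hk).trans htT
  set c : ℕ → ℕ → ℝ := fun m k ↦ ∫ ω in B i, trunc (m + 1) (W i (p m k) ω - W i s ω) ∂P with hc
  -- Cancelling `P.real (B j)` produces the increments of `g`. The factor `P.real (B i)` stays,
  -- since the truncated means `c m k` are related to `f` only in the limit.
  have hfact : ∀ m, P.real (B i) * ∫ ω in D, (R m).integral (W j) s t ω ∂P =
      P.real D * ∑ k ∈ Finset.range (m + 1), c m k * (g (p m (k + 1)) - g (p m k)) := by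
    intro m
    refine mul_left_cancel₀ hj0 ?_
    simp_rw [hR, riemannProcess_integral hWi.adapted hst]
    rw [integral_finsetSum, Finset.mul_sum, Finset.mul_sum, Finset.mul_sum, Finset.mul_sum]
    · refine Finset.sum_congr rfl fun k hk ↦ ?_
      have hk := Finset.mem_range.1 hk
      have h1 := setIntegral_iInter_mul (fun k t ↦ (hW.isFilteredBrownian k).measurable t)
        hW.iIndepFun_components hA hBA hij
        (F := fun ω ↦ trunc (m + 1) (W i (p m k) ω - W i s ω))
        (G := fun ω ↦ W j (p m (k + 1)) ω - W j (p m k) ω)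
        ((measurable_trunc _).comp
          ((measurable_processSigma (W i) _).sub (measurable_processSigma (W i) _)))
        ((measurable_processSigma (W j) _).sub (measurable_processSigma (W j) _))
      rw [hWj.setIntegral_sub, ← hgB _ (hpT m k hk.le), ← hgB _ (hpT m (k + 1) hk)] at h1
      rw [← mul_assoc, mul_comm (P.real (B j)), h1]
      ring
    · intro k _
      exact ((hWj.memLp_two_mul_increment _ _ ((measurable_trunc _).comp
        ((hWi.measurable _).sub (hWi.measurable _)))
        ⟨m + 1, fun ω ↦ abs_trunc_le (by positivity) _⟩).integrable (by norm_num)).integrableOn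
  have hS := (hasStieltjesIntegral_of_density (f := fun u ↦ f u - f s)
    (hf.sub continuousOn_const) hg' hg (s := s) htT).tendsto_regularGrid hst
  -- Removing the truncation costs at most `(t - s) / (m + 1)` per coefficient. Summed against the
  -- increments of `g` this tends to `0`, because `g` has finite variation.
  have hdiff : Tendsto (fun m ↦
      ∑ k ∈ Finset.range (m + 1), c m k * (g (p m (k + 1)) - g (p m k)) - P.real (B i) *
      ∑ k ∈ Finset.range (m + 1), (f (p m k) - f s) * (g (p m (k + 1)) - g (p m k)))
      atTop (𝓝 0) := by
    have hz : Tendsto (fun m : ℕ ↦ (((t : ℝ) - s) * ∫ u in (s : ℝ)..t, |g' u|) / ((m : ℝ) + 1))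
        atTop (𝓝 0) :=
      (tendsto_atTop_add_const_right _ _ tendsto_natCast_atTop_atTop).const_div_atTop _
    refine squeeze_zero_norm (fun m ↦ ?_) hz
    rw [Finset.mul_sum, ← Finset.sum_sub_distrib, Real.norm_eq_abs]
    have hm : (0 : ℝ) < m + 1 := by positivity
    calc |∑ k ∈ Finset.range (m + 1), (c m k * (g (p m (k + 1)) - g (p m k)) -
          P.real (B i) * ((f (p m k) - f s) * (g (p m (k + 1)) - g (p m k))))|
        ≤ ∑ k ∈ Finset.range (m + 1), |c m k * (g (p m (k + 1)) - g (p m k)) -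
          P.real (B i) * ((f (p m k) - f s) * (g (p m (k + 1)) - g (p m k)))| :=
          Finset.abs_sum_le_sum_abs _ _
      _ ≤ ∑ k ∈ Finset.range (m + 1), ((t : ℝ) - s) / (m + 1) *
          |g (p m (k + 1)) - g (p m k)| := by
          refine Finset.sum_le_sum fun k hk ↦ ?_
          have hk := Finset.mem_range.1 hk
          have e : c m k * (g (p m (k + 1)) - g (p m k)) -
              P.real (B i) * ((f (p m k) - f s) * (g (p m (k + 1)) - g (p m k))) =
              (c m k - ∫ ω in B i, (W i (p m k) ω - W i s ω) ∂P) *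
                (g (p m (k + 1)) - g (p m k)) := by
            rw [hWi.setIntegral_sub, ← hfB _ (hpT m k hk.le), ← hfB _ (hst.trans htT)]
            ring
          rw [e, abs_mul]
          gcongr
          refine (hWi.abs_setIntegral_trunc_sub_le (B i) (le_regularGrid s t m k) hm).trans ?_
          gcongr
          exact_mod_cast regularGrid_le hst hk.le
      _ = ((t : ℝ) - s) / (m + 1) * ∑ k ∈ Finset.range (m + 1),
          |g (p m (k + 1)) - g (p m k)| := by rw [Finset.mul_sum]
      _ ≤ ((t : ℝ) - s) / (m + 1) * ∫ u in (s : ℝ)..t, |g' u| := by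
          have : (s : ℝ) ≤ t := by exact_mod_cast hst
          have := sub_nonneg.2 this
          gcongr
          exact sum_abs_sub_regularGrid_le hg' hg hst htT m
      _ = _ := by ring
  have hlim2 : Tendsto (fun m ↦ P.real (B i) * ∫ ω in D, (R m).integral (W j) s t ω ∂P) atTop
      (𝓝 (P.real D * (0 + P.real (B i) * J))) := by
    simp_rw [hfact]
    refine Tendsto.const_mul _ ((hdiff.add (hS.const_mul (P.real (B i)))).congr fun m ↦ ?_)
    ring
  have h := tendsto_nhds_unique (hlim1.const_mul (P.real (B i))) hlim2
  refine mul_left_cancel₀ hi0 ?_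
  rw [h]; ring

end Riemann

/-! ### Atoms of the σ-field of the quantization. -/

/-- The event that the process `X` follows at the times in `D` the path it has at `ω₀`. -/
def fiber (D : Set ℝ≥0) (X : ℝ≥0 → Ω → ℝ) (ω₀ : Ω) : Set Ω := {ω | ∀ t ∈ D, X t ω = X t ω₀}

/-- Countability of `D` keeps the event in the σ-field; density of `D` and continuity of the paths
recover agreement on all of `[0, T]` in `eqOn_of_mem_fiber`. -/
lemma measurableSet_fiber {T : ℝ≥0} {D : Set ℝ≥0} (hD : D.Countable) (hDT : D ⊆ Iic T)
    (X : ℝ≥0 → Ω → ℝ) (ω₀ : Ω) : MeasurableSet[pathSigma T X] (fiber D X ω₀) := by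
  have : fiber D X ω₀ = ⋂ t ∈ D, X t ⁻¹' {X t ω₀} := by
    ext ω; simp [fiber]
  rw [this]
  refine MeasurableSet.biInter hD fun t ht ↦ ?_
  have h : MeasurableSpace.comap (X t) inferInstance ≤ pathSigma T X :=
    le_iSup₂_of_le t (hDT ht) le_rfl
  exact h _ ⟨{X t ω₀}, measurableSet_singleton _, rfl⟩

lemma pathSigma_le {T : ℝ≥0} {X : ℝ≥0 → Ω → ℝ} (hX : ∀ t ≤ T, Measurable (X t)) :
    pathSigma T X ≤ mΩ :=
  iSup₂_le fun t ht ↦ (hX t ht).comap_le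

lemma eqOn_of_mem_fiber {T : ℝ≥0} {D : Set ℝ≥0} (hDT : D ⊆ Iic T) (hTD : Iic T ⊆ closure D)
    {X : ℝ≥0 → Ω → ℝ} {ω ω₀ : Ω} (h : ContinuousOn (fun t ↦ X t ω) (Iic T))
    (h₀ : ContinuousOn (fun t ↦ X t ω₀) (Iic T)) (hω : ω ∈ fiber D X ω₀) :
    EqOn (fun t ↦ X t ω) (fun t ↦ X t ω₀) (Iic T) :=
  EqOn.of_subset_closure (fun t ht ↦ hω t ht) h h₀ hDT hTD

lemma pathClass_congr {T : ℝ≥0} {x y : ℝ≥0 → ℝ} (hx : ContinuousOn x (Iic T))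
    (h : EqOn x y (Iic T)) : pathClass T x = pathClass T y := by
  have hy : ContinuousOn y (Iic T) := hx.congr h.symm
  refine Lp.ext ?_
  filter_upwards [coeFn_pathClass hx, coeFn_pathClass hy, ae_restrict_mem measurableSet_Icc]
    with u h1 h2 hu
  rw [h1, h2]
  exact h (Real.toNNReal_le_iff_le_coe.2 hu.2)

lemma pathClass_const_mul {T : ℝ≥0} {x : ℝ≥0 → ℝ} (hx : ContinuousOn x (Iic T)) (c : ℝ) :
    pathClass T (fun t ↦ c * x t) = c • pathClass T x := by
  refine Lp.ext ?_
  filter_upwards [coeFn_pathClass hx, coeFn_pathClass (hx.const_smul c),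
    Lp.coeFn_smul c (pathClass T x)] with u h1 h2 h3
  rw [h3, Pi.smul_apply, h1, smul_eq_mul]
  exact h2

namespace IsContinuousStationaryQuantization

variable {T : ℝ≥0} {P : Measure Ω} {α : Set (PathL2 T)} {X Xhat : ℝ≥0 → Ω → ℝ} {D : Set ℝ≥0}

lemma ae_mem_codebook (hQ : IsContinuousStationaryQuantization T P α X Xhat) :
    ∀ᵐ ω ∂P, pathClass T (fun t ↦ Xhat t ω) ∈ α := by
  obtain ⟨C, hC, h⟩ := hQ.voronoi
  filter_upwards [h] with ω hω
  have : pathClass T (fun t ↦ X t ω) ∈ ⋃ a ∈ α, C a := by rw [hC.iUnion_eq]; trivial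
  obtain ⟨a, ha, hxa⟩ := mem_iUnion₂.1 this
  rwa [hω a ha hxa]

/-- Up to a null set, the fibers are the events `{Xhat = a}`. -/
lemma fiber_ae_eq (hQ : IsContinuousStationaryQuantization T P α X Xhat) (hT : 0 < T)
    (hDT : D ⊆ Iic T) (hTD : Iic T ⊆ closure D) {ω₀ : Ω}
    (h₀ : ContinuousOn (fun t ↦ Xhat t ω₀) (Iic T)) :
    (fiber D Xhat ω₀ : Set Ω) =ᵐ[P]
      {ω | pathClass T (fun t ↦ Xhat t ω) = pathClass T (fun t ↦ Xhat t ω₀)} := by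
  refine eventuallyEq_set.2 ?_
  filter_upwards [hQ.continuousOn] with ω hω
  exact ⟨fun h ↦ pathClass_congr hω (eqOn_of_mem_fiber hDT hTD hω h₀ h),
    fun h t ht ↦ eqOn_of_pathClass_eq hT hω h₀ h (hDT ht)⟩

/-- Up to a null set, the fibers of the quantization depend on the quantized process only. -/
lemma exists_ae_eq_fiber (hQ : IsContinuousStationaryQuantization T P α X Xhat) (hT : 0 < T)
    (hDT : D ⊆ Iic T) (hTD : Iic T ⊆ closure D) (hX : ∀ᵐ ω ∂P, Continuous (X · ω)) {ω₀ : Ω}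
    (h₀ : ContinuousOn (fun t ↦ Xhat t ω₀) (Iic T))
    (hα₀ : pathClass T (fun t ↦ Xhat t ω₀) ∈ α) :
    ∃ A, MeasurableSet[processSigma X] A ∧ (fiber D Xhat ω₀ : Set Ω) =ᵐ[P] A := by
  obtain ⟨C, hC, h⟩ := hQ.voronoi
  obtain ⟨g, hg, hgX⟩ := exists_stronglyMeasurable_pathClass (T := T) hX
  set a := pathClass T (fun t ↦ Xhat t ω₀)
  -- The event is that `X` falls into the cell of `a`, written with a representative `g` of the
  -- class of `X` that is measurable for `σ(X)`.
  refine ⟨g ⁻¹' (C a), ?_, (hQ.fiber_ae_eq hT hDT hTD h₀).trans ?_⟩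
  · borelize (PathL2 T)
    have hm : MeasurableSet (C a) := by
      have := hC.measurableSet a hα₀
      rwa [← BorelSpace.measurable_eq (α := PathL2 T)] at this
    exact hg.measurable hm
  · refine eventuallyEq_set.2 ?_
    filter_upwards [h, hgX] with ω hω hgω
    rw [mem_preimage, ← hgω]
    refine ⟨fun hωa ↦ ?_, fun hωa ↦ hω a hα₀ hωa⟩
    -- Conversely, `X` lies in some cell `C b`, which forces the quantization to equal `b`, hence `b
    -- = a`.
    have : pathClass T (fun t ↦ X t ω) ∈ ⋃ a ∈ α, C a := by rw [hC.iUnion_eq]; trivial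
    obtain ⟨b, hb, hxb⟩ := mem_iUnion₂.1 this
    have : b = a := (hω b hb hxb).symm.trans hωa
    rwa [← this]

/-- The negligible events `{Xhat = a}` are countably many, so their union is negligible. -/
lemma ae_measure_fiber_ne_zero (hQ : IsContinuousStationaryQuantization T P α X Xhat)
    (hα : α.Countable) (hT : 0 < T) (hDT : D ⊆ Iic T) (hTD : Iic T ⊆ closure D) :
    ∀ᵐ ω₀ ∂P, P (fiber D Xhat ω₀) ≠ 0 := by
  have h : ∀ᵐ ω₀ ∂P, ∀ a ∈ α, P {ω | pathClass T (fun t ↦ Xhat t ω) = a} = 0 →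
      pathClass T (fun t ↦ Xhat t ω₀) ≠ a := by
    refine (ae_ball_iff hα).2 fun a _ ↦ ?_
    by_cases h0 : P {ω | pathClass T (fun t ↦ Xhat t ω) = a} = 0
    · filter_upwards [measure_eq_zero_iff_ae_notMem.1 h0] with ω hω _ using hω
    · exact Eventually.of_forall fun ω h ↦ absurd h h0
  filter_upwards [h, hQ.ae_mem_codebook, hQ.continuousOn] with ω₀ h1 h2 h3 h0
  rw [measure_congr (hQ.fiber_ae_eq hT hDT hTD h3)] at h0
  exact h1 _ h2 h0 rfl

/-- On a fiber the quantization is the conditional mean of the process. -/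
lemma real_fiber_mul_eq_setIntegral [IsProbabilityMeasure P] {ℱ : Filtration ℝ≥0 mΩ}
    (hQ : IsContinuousStationaryQuantization T P α X Xhat) (hX : IsFilteredBrownian ℱ P X)
    (hT : 0 < T) (hD : D.Countable) (hDT : D ⊆ Iic T) (hTD : Iic T ⊆ closure D) {ω₀ : Ω}
    (h₀ : ContinuousOn (fun t ↦ Xhat t ω₀) (Iic T)) {t : ℝ≥0} (ht : t ≤ T) :
    P.real (fiber D Xhat ω₀) * Xhat t ω₀ = ∫ ω in fiber D Xhat ω₀, X t ω ∂P := by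
  set F := fiber D Xhat ω₀
  have hm := pathSigma_le hQ.measurable
  have hF : MeasurableSet[pathSigma T Xhat] F := measurableSet_fiber hD hDT Xhat ω₀
  -- Stationarity is integrated over the fiber, where the class of `Xhat` is constant. This equates
  -- the classes of two continuous functions, which therefore agree at every `t`.
  have h1 := setIntegral_condExp hm (hX.integrable_pathClass T) hF
  rw [setIntegral_congr_ae₀ (g := fun _ ↦ pathClass T (fun t ↦ Xhat t ω₀))
    (hm _ hF).nullMeasurableSet, setIntegral_const, hX.setIntegral_pathClass,
    ← pathClass_const_mul h₀] at h1
  · exact eqOn_of_pathClass_eq hT (continuousOn_const.mul h₀) (hX.continuous_setIntegral F).continuousOn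
      h1 ht
  · filter_upwards [hQ.stationary, eventuallyEq_set.1 (hQ.fiber_ae_eq hT hDT hTD h₀)] with ω h2 h3 hω
    rw [← h2]
    exact h3.1 hω

end IsContinuousStationaryQuantization

/-! ### Identification of the conditional expectation. -/

/-- A function which is measurable for the σ-field of some processes only depends on the paths. -/
lemma eq_of_measurable_iSup_pathSigma {d : ℕ} {T : ℝ≥0} {Xhat : Fin d → ℝ≥0 → Ω → ℝ} {h : Ω → ℝ}
    (hh : Measurable[⨆ k, pathSigma T (Xhat k)] h) {ω ω' : Ω}
    (heq : ∀ k, ∀ t ≤ T, Xhat k t ω = Xhat k t ω') : h ω = h ω' := by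
  have hle : (⨆ k, pathSigma T (Xhat k)) ≤
      -- The σ-field `⊤` suffices: only the fact that events are preimages under the path map is
      -- used.
      MeasurableSpace.comap (fun ω (p : Fin d × Iic T) ↦ Xhat p.1 p.2 ω) ⊤ := by
    refine iSup_le fun k ↦ iSup₂_le fun t ht ↦ ?_
    rintro _ ⟨S, -, rfl⟩
    exact ⟨{x | x (k, ⟨t, ht⟩) ∈ S}, trivial, rfl⟩
  obtain ⟨S, -, hS⟩ := hle _ (hh (measurableSet_singleton (h ω')))
  have h1 : ω' ∈ h ⁻¹' {h ω'} := rfl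
  rw [← hS] at h1
  have h2 : ω ∈ h ⁻¹' {h ω'} := by
    rw [← hS]
    have : (fun p : Fin d × Iic T ↦ Xhat p.1 p.2 ω) = fun p ↦ Xhat p.1 p.2 ω' := by
      ext p; exact heq p.1 p.2 p.2.2
    rw [mem_preimage] at h1 ⊢
    rwa [this]
  exact h2

/-- The paths of the quantization are absolutely continuous. -/
lemma absolutelyContinuousOnInterval_of_setIntegral {ℱ : Filtration ℝ≥0 mΩ}
    {P : Measure Ω} [IsProbabilityMeasure P] {X : ℝ≥0 → Ω → ℝ} (hX : IsFilteredBrownian ℱ P X)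
    {T : ℝ≥0} {A : Set Ω} (hA : P.real A ≠ 0) {g : ℝ≥0 → ℝ}
    (hg : ∀ t ≤ T, P.real A * g t = ∫ ω in A, X t ω ∂P) :
    AbsolutelyContinuousOnInterval (fun u : ℝ ↦ g u.toNNReal) 0 T := by
  have h := (hX.absolutelyContinuousOnInterval_setIntegral A T).const_mul (P.real A)⁻¹
  rw [absolutelyContinuousOnInterval_iff] at h ⊢
  intro ε hε
  obtain ⟨δ, hδ, h⟩ := h ε hε
  refine ⟨δ, hδ, fun E hE hlen ↦ lt_of_eq_of_lt ?_ (h E hE hlen)⟩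
  refine Finset.sum_congr rfl fun i hi ↦ ?_
  have hE1 := hE.1 i hi
  rw [uIcc_of_le T.coe_nonneg] at hE1
  rw [← hg _ (Real.toNNReal_le_iff_le_coe.2 hE1.1.2), ← hg _ (Real.toNNReal_le_iff_le_coe.2 hE1.2.2),
    inv_mul_cancel_left₀ hA, inv_mul_cancel_left₀ hA]

lemma integral_deriv_eq_sub_nnreal {T : ℝ≥0} {g : ℝ≥0 → ℝ}
    (hg : AbsolutelyContinuousOnInterval (fun u : ℝ ↦ g u.toNNReal) 0 T) (a b : ℝ≥0) (hab : a ≤ b)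
    (hb : b ≤ T) : ∫ u in (a : ℝ)..b, deriv (fun u : ℝ ↦ g u.toNNReal) u = g b - g a := by
  have h := (hg.mono (c := a) (d := b) (by
    rw [uIcc_of_le T.coe_nonneg]
    exact uIcc_subset_Icc ⟨a.2, by exact_mod_cast hab.trans hb⟩
      ⟨b.2, by exact_mod_cast hb⟩)).integral_deriv_eq_sub
  simpa using h

/-- The candidate for the conditional expectation of the Itô area. -/
noncomputable def pathArea (x y : ℝ≥0 → ℝ) (s t : ℝ≥0) : ℝ :=
  -- An absolutely continuous path is the integral of its almost everywhere derivative; the default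
  -- value `0` of `deriv` at the remaining points is harmless.
  ∫ u in (s : ℝ)..t, (x u.toNNReal - x s) * deriv (fun v : ℝ ↦ y v.toNNReal) u

section Main

variable {P : Measure Ω} [IsProbabilityMeasure P] {T : ℝ≥0} {d : ℕ} {ℱ : Filtration ℝ≥0 mΩ}
  {W : Fin d → ℝ≥0 → Ω → ℝ} {α : Fin d → Set (PathL2 T)} {What : Fin d → ℝ≥0 → Ω → ℝ}

/-- The fibers of the quantization at `ω` are not negligible, and the paths of the quantization are
absolutely continuous conditional means on these fibers. -/
structure IsRegularPoint (P : Measure Ω) (T : ℝ≥0) (D : Set ℝ≥0)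
    (W What : Fin d → ℝ≥0 → Ω → ℝ) (ω : Ω) : Prop where
  continuousOn : ∀ k, ContinuousOn (fun t ↦ What k t ω) (Iic T)
  fiber_ne_zero : ∀ k, P.real (fiber D (What k) ω) ≠ 0
  exists_ae_eq : ∀ k, ∃ A, MeasurableSet[processSigma (W k)] A ∧
    (fiber D (What k) ω : Set Ω) =ᵐ[P] A
  mean : ∀ k, ∀ t ≤ T,
    P.real (fiber D (What k) ω) * What k t ω = ∫ ω' in fiber D (What k) ω, W k t ω' ∂P
  absolutelyContinuous : ∀ k,
    AbsolutelyContinuousOnInterval (fun u : ℝ ↦ What k u.toNNReal ω) 0 T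

lemma ae_isRegularPoint (hW : IsBrownianMotion ℱ P W) (hT : 0 < T)
    (hα : ∀ k, (α k).Countable)
    (hWhat : ∀ k, IsContinuousStationaryQuantization T P (α k) (W k) (What k)) {D : Set ℝ≥0}
    (hD : D.Countable) (hDT : D ⊆ Iic T) (hTD : Iic T ⊆ closure D) :
    ∀ᵐ ω ∂P, IsRegularPoint P T D W What ω := by
  have hcont : ∀ᵐ ω ∂P, ∀ k, ContinuousOn (fun t ↦ What k t ω) (Iic T) :=
    ae_all_iff.2 fun k ↦ (hWhat k).continuousOn
  have hmem : ∀ᵐ ω ∂P, ∀ k, pathClass T (fun t ↦ What k t ω) ∈ α k :=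
    ae_all_iff.2 fun k ↦ (hWhat k).ae_mem_codebook
  have hpos : ∀ᵐ ω ∂P, ∀ k, P (fiber D (What k) ω) ≠ 0 :=
    ae_all_iff.2 fun k ↦ (hWhat k).ae_measure_fiber_ne_zero (hα k) hT hDT hTD
  filter_upwards [hcont, hmem, hpos] with ω h1 h2 h3
  have hpos : ∀ k, P.real (fiber D (What k) ω) ≠ 0 := fun k ↦
    (measureReal_ne_zero_iff (measure_ne_top _ _)).2 (h3 k)
  have hmean : ∀ k, ∀ t ≤ T, P.real (fiber D (What k) ω) * What k t ω =
      ∫ ω' in fiber D (What k) ω, W k t ω' ∂P := fun k t ht ↦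
    (hWhat k).real_fiber_mul_eq_setIntegral (hW.isFilteredBrownian k) hT hD hDT hTD (h1 k) ht
  exact
    { continuousOn := h1
      fiber_ne_zero := hpos
      exists_ae_eq := fun k ↦ (hWhat k).exists_ae_eq_fiber hT hDT hTD
        (hW.isBrownianReal k).cont (h1 k) (h2 k)
      mean := hmean
      absolutelyContinuous := fun k ↦ absolutelyContinuousOnInterval_of_setIntegral
        (g := fun t ↦ What k t ω) (hW.isFilteredBrownian k) (hpos k) (hmean k) }

/-- By independence the probability of the atom is the product of those of the fibers, none of which
vanishes. -/
lemma real_iInter_fiber_ne_zero (hW : IsBrownianMotion ℱ P W) {D : Set ℝ≥0} {ω : Ω}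
    (hω : IsRegularPoint P T D W What ω) : P.real (⋂ k, fiber D (What k) ω) ≠ 0 := by
  choose A hA hBA using hω.exists_ae_eq
  have h := integral_prod_indicator_mul (fun k ↦ (hW.isFilteredBrownian k).measurable)
    hW.iIndepFun_components hA (h := fun _ _ ↦ 1) (fun k ↦ measurable_const)
  simp only [Finset.prod_const_one, integral_const, smul_eq_mul, mul_one,
    measureReal_restrict_apply_univ] at h
  rw [measureReal_congr (Filter.EventuallyEq.countable_iInter hBA), h]
  refine Finset.prod_ne_zero_iff.2 fun k _ ↦ ?_
  rw [← measureReal_congr (hBA k)]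
  exact hω.fiber_ne_zero k

/-- The conditional expectation of the Itô area is the Stieltjes area of the quantization. -/
lemma pathArea_ae_eq_condExp (hW : IsBrownianMotion ℱ P W) (hT : 0 < T)
    (hα : ∀ k, (α k).Countable)
    (hWhat : ∀ k, IsContinuousStationaryQuantization T P (α k) (W k) (What k)) {i j : Fin d}
    (hij : i ≠ j) {s t : ℝ≥0} (hst : s ≤ t) (htT : t ≤ T) {X : Ω → ℝ}
    (hX : IsItoIntegral ℱ P (W j) (fun u ω ↦ W i u ω - W i s ω) s t X) :
    (fun ω ↦ pathArea (fun u ↦ What i u ω) (fun u ↦ What j u ω) s t) =ᵐ[P]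
      P[X | ⨆ k, pathSigma T (What k)] := by
  obtain ⟨D, hDT, hD, hTD⟩ :=
    (isCompact_Iic_nnreal T).isSeparable.exists_countable_dense_subset
  set G : MeasurableSpace Ω := ⨆ k, pathSigma T (What k) with hG
  have hGle : G ≤ mΩ := iSup_le fun k ↦ pathSigma_le (hWhat k).measurable
  have hreg := ae_isRegularPoint hW hT hα hWhat hD hDT hTD
  filter_upwards [hreg] with ω₀ h₀
  choose A hA hBA using h₀.exists_ae_eq
  have hDm : MeasurableSet[G] (⋂ k, fiber D (What k) ω₀) :=
    MeasurableSet.iInter fun k ↦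
      (le_iSup (fun k ↦ pathSigma T (What k)) k) _ (measurableSet_fiber hD hDT (What k) ω₀)
  have key := setIntegral_itoIntegral hW hA hBA hij (h₀.fiber_ne_zero i) (h₀.fiber_ne_zero j)
    (h₀.continuousOn i) (h₀.mean i) (h₀.mean j) (h₀.absolutelyContinuous j).intervalIntegrable_deriv
    (integral_deriv_eq_sub_nnreal (g := fun u ↦ What j u ω₀) (h₀.absolutelyContinuous j)) hst htT hX
  -- A `G`-measurable function depends only on the paths of the quantization, hence is almost
  -- everywhere equal to its value at `ω₀` on the atom; dividing by the positive probability of the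
  -- atom gives that value.
  rw [← setIntegral_condExp hGle (hX.1.integrable (by norm_num)) hDm, setIntegral_congr_ae₀
    (g := fun _ ↦ (P[X | G]) ω₀) (hGle _ hDm).nullMeasurableSet, setIntegral_const,
    smul_eq_mul] at key
  · exact (mul_left_cancel₀ (real_iInter_fiber_ne_zero hW h₀) key).symm
  · filter_upwards [hreg] with ω hω hωD
    refine eq_of_measurable_iSup_pathSigma (T := T) (Xhat := What)
      stronglyMeasurable_condExp.measurable fun k t ht ↦ ?_
    exact eqOn_of_mem_fiber hDT hTD (hω.continuousOn k) (h₀.continuousOn k)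
      (mem_iInter.1 hωD k) ht

/-- Regularity of `ω` does not involve `(s, t)`, so all claims hold on one event of full
probability. -/
lemma ae_continuousOn_pathArea (hW : IsBrownianMotion ℱ P W) (hT : 0 < T)
    (hα : ∀ k, (α k).Countable)
    (hWhat : ∀ k, IsContinuousStationaryQuantization T P (α k) (W k) (What k)) :
    ∀ᵐ ω ∂P, ∀ i j : Fin d,
      ContinuousOn (fun p : ℝ≥0 × ℝ≥0 ↦
        pathArea (fun u ↦ What i u ω) (fun u ↦ What j u ω) p.1 p.2) {p | p.1 ≤ p.2 ∧ p.2 ≤ T} ∧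
      ∀ s t : ℝ≥0, s ≤ t → t ≤ T →
        HasStieltjesIntegral (fun u ↦ What i u ω - What i s ω) (fun u ↦ What j u ω) s t
          (pathArea (fun u ↦ What i u ω) (fun u ↦ What j u ω) s t) := by
  obtain ⟨D, hDT, hD, hTD⟩ :=
    (isCompact_Iic_nnreal T).isSeparable.exists_countable_dense_subset
  filter_upwards [ae_isRegularPoint hW hT hα hWhat hD hDT hTD] with ω h₀ i j
  have hint := (h₀.absolutelyContinuous j).intervalIntegrable_deriv
  refine ⟨continuousOn_area (h₀.continuousOn i) hint, fun s t _ htT ↦ ?_⟩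
  exact hasStieltjesIntegral_of_density (f := fun u ↦ What i u ω - What i s ω)
    ((h₀.continuousOn i).sub continuousOn_const) hint
    (integral_deriv_eq_sub_nnreal (g := fun u ↦ What j u ω) (h₀.absolutelyContinuous j)) htT

end Main

end BrownianQuantization

theorem mainTheorem6 {Ω : Type*} {mΩ : MeasurableSpace Ω} (P : Measure Ω) [IsProbabilityMeasure P]
    (T : ℝ≥0) (hT : 0 < T) (d : ℕ) (ℱ : Filtration ℝ≥0 mΩ)
    (W : Fin d → ℝ≥0 → Ω → ℝ) (hW : BrownianQuantization.IsBrownianMotion ℱ P W)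
    (α : Fin d → Set (BrownianQuantization.PathL2 T)) (hα : ∀ i, (α i).Countable)
    (What : Fin d → ℝ≥0 → Ω → ℝ)
    (hWhat : ∀ i,
      BrownianQuantization.IsContinuousStationaryQuantization T P (α i) (W i) (What i)) :
    -- the Itô areas exist
    (∀ i j : Fin d, i ≠ j → ∀ s t : ℝ≥0, s ≤ t → t ≤ T →
      ∃ X : Ω → ℝ, BrownianQuantization.IsItoIntegral ℱ P (W j)
        (fun u ω ↦ W i u ω - W i s ω) s t X) ∧
    -- for any versions `I i j s t` of the Itô areas
    ∀ I : Fin d → Fin d → ℝ≥0 → ℝ≥0 → Ω → ℝ,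
      (∀ i j : Fin d, i ≠ j → ∀ s t : ℝ≥0, s ≤ t → t ≤ T →
        BrownianQuantization.IsItoIntegral ℱ P (W j)
          (fun u ω ↦ W i u ω - W i s ω) s t (I i j s t)) →
      -- their conditional expectations have versions `Y i j s t` which, almost surely, are
      -- continuous in `(s, t)` and equal to the Stieltjes areas for all `i ≠ j` and `s ≤ t ≤ T`
      ∃ Y : Fin d → Fin d → ℝ≥0 → ℝ≥0 → Ω → ℝ,
        (∀ i j : Fin d, i ≠ j → ∀ s t : ℝ≥0, s ≤ t → t ≤ T →
          Y i j s t =ᵐ[P] P[I i j s t | ⨆ k, BrownianQuantization.pathSigma T (What k)]) ∧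
        ∀ᵐ ω ∂P, ∀ i j : Fin d, i ≠ j →
          ContinuousOn (fun p : ℝ≥0 × ℝ≥0 ↦ Y i j p.1 p.2 ω) {p | p.1 ≤ p.2 ∧ p.2 ≤ T} ∧
          ∀ s t : ℝ≥0, s ≤ t → t ≤ T →
            BrownianQuantization.HasStieltjesIntegral (fun u ↦ What i u ω - What i s ω)
              (fun u ↦ What j u ω) s t (Y i j s t ω) := by
  refine ⟨fun i j _ s t hst _ ↦ BrownianQuantization.exists_isItoIntegral
    (hW.isFilteredBrownian i) (hW.isFilteredBrownian j) hst, fun I hI ↦ ?_⟩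
  refine ⟨fun i j s t ω ↦
    BrownianQuantization.pathArea (fun u ↦ What i u ω) (fun u ↦ What j u ω) s t, ?_, ?_⟩
  · exact fun i j hij s t hst htT ↦ BrownianQuantization.pathArea_ae_eq_condExp hW hT hα hWhat hij
      hst htT (hI i j hij s t hst htT)
  · filter_upwards [BrownianQuantization.ae_continuousOn_pathArea hW hT hα hWhat] with ω hω i j _
    exact hω i j
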